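/- Let $K$ be a number field of signature $(s,t)$, that is, with $s$ real embeddings $\sigma_1,\dots,\sigma_s$ and $t$ pairs of complex conjugate non-real embeddings $\tau_j,\overline{\tau_j}$ ($1\le j\le t$), and let $\mathbb{Z}_K$ be its ring of integers. Let $\Lambda_K\subset\mathbb{R}^s\times\mathbb{C}^t$ be the lattice of all vectors $(\sigma_1(\alpha),\dots,\sigma_s(\alpha),\tau_1(\alpha),\dots,\tau_t(\alpha))$ with $\alpha\in\mathbb{Z}_K$, let $d(\Lambda_K)$ be the Euclidean length of a shortest non-zero vector of $\Lambda_K$, and put $$m(K)=\frac{d(\Lambda_K)^2}{s+t}=\min_{0\ne\alpha\in\mathbb{Z}_K}\frac{1}{s+t}\Bigl(\sum_{i=1}^{s}\sigma_i(\alpha)^2+\sum_{j=1}^{t}|\tau_j(\alpha)|^2\Bigr).$$ (i) Every number field $K=\mathbb{Q}(\alpha)$ generated by a root $\alpha$ of $x^6+x^2-1$ has degree $6$ and signature $(2,2)$ and satisfies $m(K)=0.946467\ldots$ (that is, $0.946467\le m(K)<0.946468$), and $m(K)\le m(L)$ for every number field $L$ of degree $6$ and signature $(2,2)$. Thus $0.946467\ldots$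 is the smallest value of $m$ among sextic number fields of signature $(2,2)$, and it is attained by such $K$. (ii) Every number field $K$ of degree $6$ and signature $(4,1)$ satisfies $m(K)=1$. -/

import Mathlib

open NumberField NumberField.InfinitePlace

noncomputable section

/-- `K` has signature `(s, t)`: it has `s` real embeddings and `t` pairs of complex conjugate
(non-real) embeddings. -/
def HasSignature (K : Type*) [Field K] [NumberField K] (s t : ℕ) : Prop :=
  nrRealPlaces K = s ∧ nrComplexPlaces K = t

/-- The lattice `Λ_K = ψ(ℤ_K)`, where `ψ : K → ℝ^s × ℂ^t` is given by the real embeddings and by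
one embedding out of each pair of complex ones. The ambient space carries the Euclidean norm
`(∑ x_i ^ 2 + ∑ (y_j ^ 2 + z_j ^ 2)) ^ (1 / 2)`. -/
abbrev fieldLattice (K : Type*) [Field K] [NumberField K] :
    Submodule ℤ (mixedEmbedding.euclidean.mixedSpace K) :=
  mixedEmbedding.euclidean.integerLattice K

open scoped Classical in
/-- The minimum distance `d(Λ_K)`: the length of a shortest non-zero vector of `Λ_K`. The infimum
is attained, see `isLeast_minDistance`. -/
def minDistance (K : Type*) [Field K] [NumberField K] : ℝ :=
  sInf {r : ℝ | ∃ x ∈ fieldLattice K, x ≠ 0 ∧ r = ‖x‖}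

/-- `m(K) = d(Λ_K) ^ 2 / (s + t)`, where `(s, t)` is the signature of `K`. -/
def normalizedMin (K : Type*) [Field K] [NumberField K] : ℝ :=
  minDistance K ^ 2 / ((nrRealPlaces K : ℝ) + (nrComplexPlaces K : ℝ))

/-- The lattice consists of the images of the algebraic integers of `K`. -/
theorem mem_fieldLattice_iff (K : Type*) [Field K] [NumberField K]
    (x : mixedEmbedding.euclidean.mixedSpace K) :
    x ∈ fieldLattice K ↔
      ∃ a : 𝓞 K, mixedEmbedding K (a : K) = mixedEmbedding.euclidean.toMixed K x := by
  change mixedEmbedding.euclidean.toMixed K x ∈ mixedEmbedding.integerLattice K ↔ _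
  simp [mixedEmbedding.integerLattice]

open scoped Classical in
/-- The squared length of the vector attached to `a` is the sum of the squared absolute values of
`a` under the `s + t` embeddings. -/
theorem norm_sq_eq_of_toMixed (K : Type*) [Field K] [NumberField K] (a : K)
    (x : mixedEmbedding.euclidean.mixedSpace K)
    (hx : mixedEmbedding K a = mixedEmbedding.euclidean.toMixed K x) :
    ‖x‖ ^ 2 = ∑ w : InfinitePlace K, w a ^ 2 := by
  have hr : ∀ w : {w : InfinitePlace K // IsReal w}, ‖x.fst w‖ = w.1 a := fun w => by
    rw [← mixedEmbedding.normAtPlace_apply w.1 a, hx,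
      mixedEmbedding.normAtPlace_apply_of_isReal w.2]
    rfl
  have hc : ∀ w : {w : InfinitePlace K // IsComplex w}, ‖x.snd w‖ = w.1 a := fun w => by
    rw [← mixedEmbedding.normAtPlace_apply w.1 a, hx,
      mixedEmbedding.normAtPlace_apply_of_isComplex w.2]
    rfl
  rw [WithLp.prod_norm_sq_eq_of_L2, EuclideanSpace.norm_sq_eq, EuclideanSpace.norm_sq_eq,
    ← Fintype.sum_subtype_add_sum_subtype (fun w : InfinitePlace K => IsReal w)]
  congr 1
  · exact Finset.sum_congr rfl fun w _ => by rw [hr]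
  · simp only [hc]
    exact Fintype.sum_equiv (Equiv.subtypeEquivRight fun w => not_isReal_iff_isComplex.symm) _ _
      fun w => rfl

open scoped Classical in
/-- `d(Λ_K)` is the length of an actual non-zero lattice vector. -/
theorem isLeast_minDistance (K : Type*) [Field K] [NumberField K] :
    IsLeast {r : ℝ | ∃ x ∈ fieldLattice K, x ≠ 0 ∧ r = ‖x‖} (minDistance K) := by
  have hb : BddBelow {r : ℝ | ∃ x ∈ fieldLattice K, x ≠ 0 ∧ r = ‖x‖} :=
    ⟨0, by rintro r ⟨x, -, -, rfl⟩; exact norm_nonneg x⟩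
  refine ⟨?_, fun r hr => csInf_le hb hr⟩
  -- a non-zero lattice vector
  obtain ⟨x₀, hx₀⟩ : ∃ x₀, mixedEmbedding.euclidean.toMixed K x₀ = mixedEmbedding K 1 :=
    (mixedEmbedding.euclidean.toMixed K).surjective _
  have hx₀m : x₀ ∈ fieldLattice K := (mem_fieldLattice_iff K x₀).2 ⟨1, by simp [hx₀]⟩
  have hx₀0 : x₀ ≠ 0 := by
    rintro rfl
    simp at hx₀
  -- only finitely many lattice vectors are at most as long
  have hd : DiscreteTopology (fieldLattice K).toAddSubgroup :=
    inferInstanceAs (DiscreteTopology (mixedEmbedding.euclidean.integerLattice K))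
  have hcl : IsClosed ((fieldLattice K : Submodule ℤ _) :
      Set (mixedEmbedding.euclidean.mixedSpace K)) :=
    AddSubgroup.isClosed_of_discrete (H := (fieldLattice K).toAddSubgroup)
  have hfin : (Metric.closedBall (0 : mixedEmbedding.euclidean.mixedSpace K) ‖x₀‖ ∩
      (fieldLattice K : Set (mixedEmbedding.euclidean.mixedSpace K))).Finite :=
    Metric.finite_isBounded_inter_isClosed hd.isDiscrete Metric.isBounded_closedBall hcl
  obtain ⟨y, ⟨⟨hy1, hy2⟩, hy0⟩, hmin⟩ := Set.exists_min_image _ (fun z => ‖z‖)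
    (hfin.subset (Set.sdiff_subset (t := {0}))) ⟨x₀, ⟨by simp, hx₀m⟩, hx₀0⟩
  have hle : ‖y‖ ≤ ‖x₀‖ := by simpa using hy1
  have hl : IsLeast {r : ℝ | ∃ x ∈ fieldLattice K, x ≠ 0 ∧ r = ‖x‖} ‖y‖ := by
    refine ⟨⟨y, hy2, hy0, rfl⟩, ?_⟩
    rintro r ⟨z, hz, hz0, rfl⟩
    rcases le_total ‖z‖ ‖x₀‖ with h | h
    · exact hmin z ⟨⟨by simpa using h, hz⟩, hz0⟩
    · exact hle.trans h
  rw [minDistance, hl.csInf_eq]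
  exact hl.1

end

/-! For an algebraic integer `α`, the sum of squared absolute values over the places is `∑ a i ^ 2 +
∑ B j`, where the characteristic polynomial is `∏ (X - a i) * ∏ (X ^ 2 - t j * X + B j)`. This
polynomial has integer coefficients, and it vanishes at an integer `k` only if `α = k`. So for `α ≠
0, 1, -1` the norms of `α`, `1 - α` and `-1 - α` all have absolute value at least 1, and the problem
becomes one about real numbers.

Signature (4,1). The integers `1` and `-1` give the value 5. For the others, add `3/4` of `log
|N(α)|² ≥ 0` and `1/4` of the analogous bound for `1 - α²`. Tangent-line bounds for the logarithm,
one place at a time, turn this into `∑ ≥ 5` (`five_le_sum_sq_of_signature_four_one`).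

Signature (2,2). Let `v₀` be the positive root of `x⁶ + x² - 1`; the claimed minimum of the sum is
`2v₀² + 2/v₀`. Suppose some `α` has a smaller sum, and put `v² = |a₁a₂|`, `w = b₁b₂` with `B j = b j
^ 2`. The AM-GM inequality forces norm ±1, so `vw = 1`. The sum is then `2v² + 2/v` plus a defect
that vanishes when `|a₁| = |a₂|` and `b₁ = b₂`. The least value of `2v² + 2/v` is so close to its
value at `v₀` that the defect is below 0.0063, and `v < v₀` (`mean_bounds`). Real roots of equal
sign would make `1 - α` or `1 + α` too small at the real places (`real_roots_not_same_sign`). For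
opposite signs the trace lies in `{-1, 0, 1}`. Traces ±1 are excluded by locating two coefficients
(`trace_ne_one`). Trace 0 makes the polynomial even, and a short list of cubics in `X²` is left
(`trinomial_coeff_false`). The critical one, `y³ + y - 1`, is excluded only because `v < v₀`.

Conversely, a root of `x⁶ + x² - 1` attains the bound: its real conjugates are `±v₀`, and all others
have squared absolute value `1/v₀`. -/

open Polynomial

/-! ### Characteristic polynomials and lattice vectors -/

/-- The polynomial with roots the conjugates of an algebraic integer has integral coefficients. -/
theorem exists_map_eq_prod_embeddings {K : Type*} [Field K] [NumberField K] (α : 𝓞 K) :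
    ∃ P : ℤ[X], P.map (Int.castRingHom ℂ) = ∏ φ : K →+* ℂ, (X - C (φ α)) := by
  classical
  let b := RingOfIntegers.basis K
  refine ⟨(Algebra.leftMulMatrix b α).charpoly, ?_⟩
  -- At every integer `k` both polynomials take the value `N(k - α)`.
  refine Polynomial.eq_of_infinite_eval_eq _ _
    ((Set.infinite_range_of_injective (Int.cast_injective (α := ℂ))).mono ?_)
  rintro _ ⟨k, rfl⟩
  have h1 : ((Algebra.leftMulMatrix b α).charpoly).eval k = Algebra.norm ℤ ((k : 𝓞 K) - α) := by
    rw [Matrix.eval_charpoly, Algebra.norm_eq_matrix_det b, map_sub]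
    congr 2
    rw [map_intCast]
    rfl
  have h2 : ((Algebra.norm ℤ ((k : 𝓞 K) - α) : ℚ) : ℂ) = ∏ φ : K →+* ℂ, ((k : ℂ) - φ α) := by
    rw [Algebra.coe_norm_int, ← eq_ratCast (algebraMap ℚ ℂ), Algebra.norm_eq_prod_embeddings ℚ ℂ]
    refine (Fintype.prod_equiv (RingHom.equivRatAlgHom K ℂ) _ _ fun φ => ?_).symm
    simp [RingHom.equivRatAlgHom_apply]
  rw [Set.mem_ofPred_eq, eval_prod]
  simp only [eval_sub, eval_X, eval_C]
  rw [← h2, ← h1]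
  simp [Polynomial.eval_intCast_map]

open scoped Classical in
/-- The real polynomial whose roots are the images of `x` under the embeddings above a place. -/
noncomputable def placeFactor {K : Type*} [Field K] (w : InfinitePlace K) (x : K) : ℝ[X] :=
  if IsReal w then X - C (w.embedding x).re
  else X ^ 2 - C (2 * (w.embedding x).re) * X + C (‖w.embedding x‖ ^ 2)

open scoped Classical in
theorem prod_filter_mk_eq_map_placeFactor {K : Type*} [Field K] [NumberField K]
    (w : InfinitePlace K) (x : K) :
    ∏ φ with mk φ = w, (X - C (φ x)) = (placeFactor w x).map (algebraMap ℝ ℂ) := by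
  have hf : Finset.univ.filter (fun φ : K →+* ℂ => mk φ = w) =
      {w.embedding, ComplexEmbedding.conjugate w.embedding} := by
    ext φ
    simp only [Finset.mem_filter, Finset.mem_univ, true_and, Finset.mem_insert,
      Finset.mem_singleton]
    conv_lhs => rw [← mk_embedding w, eq_comm, mk_eq_iff]
    tauto
  rw [hf]
  by_cases hw : IsReal w
  · rw [ComplexEmbedding.isReal_iff.mp (isReal_iff.mp hw)]
    have hx : (((w.embedding x).re : ℝ) : ℂ) = w.embedding x := by
      rw [← Complex.conj_eq_iff_re]
      exact RingHom.congr_fun (isReal_iff.mp hw) x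
    simp [placeFactor, hw, hx]
  · rw [Finset.prod_pair]
    · have h1 : (C ((2 * (w.embedding x).re : ℝ) : ℂ) : ℂ[X]) =
          C (w.embedding x) + C ((starRingEnd ℂ) (w.embedding x)) := by
        rw [← C_add, Complex.add_conj]
      have h2 : (C ((‖w.embedding x‖ ^ 2 : ℝ) : ℂ) : ℂ[X]) =
          C (w.embedding x) * C ((starRingEnd ℂ) (w.embedding x)) := by
        rw [← C_mul, Complex.mul_conj, Complex.normSq_eq_norm_sq]
      simp only [placeFactor, hw, if_false, Polynomial.map_add, Polynomial.map_sub,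
        Polynomial.map_mul, Polynomial.map_pow, map_X, map_C, Complex.coe_algebraMap, h1, h2,
        ComplexEmbedding.conjugate_coe_eq]
      ring
    · rwa [Ne, eq_comm, ← ComplexEmbedding.isReal_iff, ← isReal_iff]

open scoped Classical in
theorem prod_embeddings_eq_prod_placeFactor {K : Type*} [Field K] [NumberField K] (x : K) :
    ∏ φ : K →+* ℂ, (X - C (φ x)) = (∏ w, placeFactor w x).map (algebraMap ℝ ℂ) := by
  rw [Polynomial.map_prod, ← Finset.prod_fiberwise Finset.univ mk]
  exact Finset.prod_congr rfl fun w _ => prod_filter_mk_eq_map_placeFactor w x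

open scoped Classical in
/-- The characteristic polynomial of an algebraic integer in a field of signature `(s, r)`, factored
over `ℝ`. -/
theorem exists_charpoly_of_hasSignature {K : Type*} [Field K] [NumberField K] {s r : ℕ}
    (hK : HasSignature K s r) (α : 𝓞 K) :
    ∃ (a : Fin s → ℝ) (t B : Fin r → ℝ) (P : ℤ[X]), (∀ j, t j ^ 2 ≤ 4 * B j) ∧
      P.map (Int.castRingHom ℝ) = (∏ i, (X - C (a i))) * ∏ j, (X ^ 2 - C (t j) * X + C (B j)) ∧
      ∑ w : InfinitePlace K, w α ^ 2 = ∑ i, a i ^ 2 + ∑ j, B j ∧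
      ∀ k : ℤ, P.eval k = 0 → α = k := by
  obtain ⟨P, hP⟩ := exists_map_eq_prod_embeddings α
  let e : {w : InfinitePlace K // IsReal w} ≃ Fin s := Fintype.equivFinOfCardEq hK.1
  let f : {w : InfinitePlace K // IsComplex w} ≃ Fin r := Fintype.equivFinOfCardEq hK.2
  refine ⟨fun i => ((e.symm i).1.embedding α).re, fun j => 2 * ((f.symm j).1.embedding α).re,
    fun j => ‖(f.symm j).1.embedding α‖ ^ 2, P, fun j => ?_, ?_, ?_, fun k hk => ?_⟩
  · have := Complex.abs_re_le_norm ((f.symm j).1.embedding (α : K))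
    have := sq_le_sq' (abs_le.mp this).1 (abs_le.mp this).2
    dsimp only
    linarith
  · apply Polynomial.map_injective (algebraMap ℝ ℂ) (algebraMap ℝ ℂ).injective
    rw [Polynomial.map_map]
    have hc : (algebraMap ℝ ℂ).comp (Int.castRingHom ℝ) = Int.castRingHom ℂ := RingHom.ext_int _ _
    rw [hc, hP, prod_embeddings_eq_prod_placeFactor, prod_eq_prod_mul_prod]
    congr 2
    · refine Fintype.prod_equiv e _ _ fun w => ?_
      simp [placeFactor, w.2]
    · refine Fintype.prod_equiv f _ _ fun w => ?_
      simp [placeFactor, not_isReal_iff_isComplex.mpr w.2]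
  · rw [sum_eq_sum_add_sum]
    congr 1
    · refine Fintype.sum_equiv e _ _ fun w => ?_
      dsimp only
      rw [Equiv.symm_apply_apply, ← norm_embedding_eq, ← sq_abs (w.1.embedding (α : K)).re,
        Complex.abs_re_eq_norm.mpr]
      exact Complex.conj_eq_iff_im.mp (RingHom.congr_fun (isReal_iff.mp w.2) _)
    · refine Fintype.sum_equiv f _ _ fun w => ?_
      rw [Equiv.symm_apply_apply, norm_embedding_eq]
  -- A zero at `k` means `φ α = k = φ k` for some embedding `φ`, which is injective.
  · have h := congrArg (Polynomial.eval (k : ℂ)) hP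
    rw [Polynomial.eval_intCast_map, Int.cast_id, hk, eval_prod] at h
    simp only [map_zero, eval_sub, eval_X, eval_C] at h
    obtain ⟨φ, -, hφ⟩ := Finset.prod_eq_zero_iff.mp h.symm
    apply RingOfIntegers.ext
    apply φ.injective
    rw [← sub_eq_zero.mp hφ]
    simp

/-- `d(Λ_K) ^ 2` is the least value of the sum of the squared absolute values. -/
theorem le_minDistance_sq {K : Type*} [Field K] [NumberField K] {c : ℝ}
    (h : ∀ α : 𝓞 K, α ≠ 0 → c ≤ ∑ w : InfinitePlace K, w α ^ 2) : c ≤ minDistance K ^ 2 := by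
  obtain ⟨x, hx, hx0, he⟩ := (isLeast_minDistance K).1
  obtain ⟨α, hα⟩ := (mem_fieldLattice_iff K x).1 hx
  rw [he, norm_sq_eq_of_toMixed K α x hα]
  convert! h α _
  rintro rfl
  apply hx0
  simpa using hα.symm

open scoped Classical in
theorem minDistance_sq_le {K : Type*} [Field K] [NumberField K] (α : 𝓞 K) (hα : α ≠ 0) :
    minDistance K ^ 2 ≤ ∑ w : InfinitePlace K, w α ^ 2 := by
  obtain ⟨x, hx⟩ := (mixedEmbedding.euclidean.toMixed K).surjective (mixedEmbedding K α)
  have hn := norm_sq_eq_of_toMixed K α x hx.symm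
  have hmem : ‖x‖ ∈ {r : ℝ | ∃ x ∈ fieldLattice K, x ≠ 0 ∧ r = ‖x‖} := by
    refine ⟨x, (mem_fieldLattice_iff K x).2 ⟨α, hx.symm⟩, ?_, rfl⟩
    rintro rfl
    rw [map_zero, eq_comm, map_eq_zero] at hx
    exact hα (RingOfIntegers.ext hx)
  have h0 : 0 ≤ minDistance K := by
    obtain ⟨y, -, -, he⟩ := (isLeast_minDistance K).1
    exact he ▸ norm_nonneg y
  have hle := (isLeast_minDistance K).2 hmem
  calc minDistance K ^ 2 ≤ ‖x‖ ^ 2 := by gcongr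
    _ = _ := hn

/-! ### Signature (4,1) -/

theorem log_div_add_log_le {x p : ℝ} (hx : 0 < x) (hp : 0 < p) :
    Real.log x ≤ x / p - 1 + Real.log p := by
  have := Real.log_le_sub_one_of_pos (div_pos hx hp)
  rw [Real.log_div hx.ne' hp.ne'] at this
  linarith

theorem log_three_le : Real.log 3 ≤ 2 * Real.log 2 - 1 / 4 := by
  have h := log_div_add_log_le (x := 3) (p := 4) (by norm_num) (by norm_num)
  rw [show (4 : ℝ) = 2 ^ 2 by norm_num, Real.log_pow] at h
  norm_num at h ⊢
  linarith

theorem le_log_five : 2 * Real.log 2 + 1 / 5 ≤ Real.log 5 := by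
  have h := log_div_add_log_le (x := 4) (p := 5) (by norm_num) (by norm_num)
  rw [show (4 : ℝ) = 2 ^ 2 by norm_num, Real.log_pow] at h
  norm_num at h ⊢
  linarith

/-- Tangent lines at `x = 1/2`, or at `x = 3/2` when `x > 1`. These are the stationary points of the
left side minus `x`, so the weighted slopes add up to exactly 1. Equality holds at `x = 1/2`. -/
theorem weighted_log_real_le {x : ℝ} (hx : 0 < x) (hx1 : x ≠ 1) :
    3 / 4 * Real.log x + 1 / 4 * Real.log |1 - x| + Real.log 2 ≤ x - 1 / 2 := by
  rcases lt_or_gt_of_ne hx1 with h | h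
  · rw [abs_of_pos (by linarith)]
    have h1 := log_div_add_log_le hx (p := 1 / 2) (by norm_num)
    have h2 := log_div_add_log_le (x := 1 - x) (p := 1 / 2) (by linarith) (by norm_num)
    rw [one_div, Real.log_inv, div_inv_eq_mul] at h1 h2
    linarith
  · rw [abs_of_neg (by linarith)]
    have h1 := log_div_add_log_le hx (p := 3 / 2) (by norm_num)
    have h2 := log_div_add_log_le (x := -(1 - x)) (p := 1 / 2) (by linarith) (by norm_num)
    rw [Real.log_div (by norm_num) (by norm_num)] at h1
    rw [one_div, Real.log_inv, div_inv_eq_mul] at h2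
    have := log_three_le
    have := Real.log_two_lt_d9
    linarith

/-- Tangent points `9/5` for `B` and `3` for `1 + B`: the weighted slopes `5/6 + 1/6` add up to 1,
near the true maximum `B = (1 + √7)/2`. The constant `-3 + 4 log 2` balances four copies of
`weighted_log_real_le` against 5. -/
theorem weighted_log_complex_le {B : ℝ} (hB : 0 < B) :
    3 / 2 * Real.log B + 1 / 2 * Real.log (1 + B) ≤ B - 3 + 4 * Real.log 2 := by
  have h1 := log_div_add_log_le hB (p := 9 / 5) (by norm_num)
  have h2 := log_div_add_log_le (x := 1 + B) (p := 3) (by linarith) (by norm_num)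
  rw [Real.log_div (by norm_num) (by norm_num), show (9 : ℝ) = 3 ^ 2 by norm_num,
    Real.log_pow] at h1
  have := log_three_le
  have := le_log_five
  have := Real.log_two_lt_d9
  push_cast at h1
  linarith

theorem five_le_sum_sq_of_signature_four_one (a : Fin 4 → ℝ) (t B : ℝ)
    (ht : t ^ 2 ≤ 4 * B)
    (h0 : 1 ≤ |(∏ i, a i) * B|)
    (h1 : 1 ≤ |(∏ i, (1 - a i)) * (1 - t + B)|)
    (h2 : 1 ≤ |(∏ i, (-1 - a i)) * (1 + t + B)|) :
    5 ≤ ∑ i, a i ^ 2 + B := by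
  have hB0 : 0 ≤ B := by nlinarith [sq_nonneg t]
  have hB : 0 < B := lt_of_le_of_ne hB0 (by rintro rfl; norm_num at h0)
  have ha : ∀ i, a i ≠ 0 := fun i hi => by
    rw [Finset.prod_eq_zero (Finset.mem_univ i) hi] at h0
    norm_num at h0
  have ha1 : ∀ i, 1 - a i ^ 2 ≠ 0 := fun i hi => by
    have : (1 - a i) * (-1 - a i) = 0 := by linear_combination -hi
    rcases mul_eq_zero.mp this with h | h
    · rw [Finset.prod_eq_zero (Finset.mem_univ i) h] at h1
      norm_num at h1
    · rw [Finset.prod_eq_zero (Finset.mem_univ i) h] at h2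
      norm_num at h2
  have hx : ∀ i, 0 < a i ^ 2 := fun i => by have := ha i; positivity
  have e0 : 0 ≤ ∑ i, Real.log (a i ^ 2) + 2 * Real.log B := by
    have : 1 ≤ (∏ i, a i ^ 2) * B ^ 2 := by
      rw [Finset.prod_pow, ← mul_pow, ← sq_abs]
      exact one_le_pow₀ h0
    have h := Real.log_nonneg this
    rwa [Real.log_mul (Finset.prod_ne_zero_iff.mpr fun i _ => (hx i).ne') (by positivity),
      Real.log_prod (fun i _ => (hx i).ne'), Real.log_pow] at h
  -- The product of the norms of `1 - α` and `-1 - α`; at the complex place, `|1 - z²| ≤ 1 + |z|²`.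
  have e1 : 0 ≤ ∑ i, Real.log |1 - a i ^ 2| + 2 * Real.log (1 + B) := by
    have h3 : 1 ≤ (∏ i, |1 - a i ^ 2|) * (1 + B) ^ 2 := by
      have h4 := one_le_mul_of_one_le_of_one_le h1 h2
      have h5 : |(∏ i, (1 - a i)) * (1 - t + B)| * |(∏ i, (-1 - a i)) * (1 + t + B)| =
          (∏ i, |1 - a i ^ 2|) * |(1 + B) ^ 2 - t ^ 2| := by
        rw [← Finset.abs_prod, ← abs_mul, ← abs_mul]
        simp only [Fin.prod_univ_four]
        congr 1
        ring
      rw [h5] at h4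
      have h6 : |(1 + B) ^ 2 - t ^ 2| ≤ (1 + B) ^ 2 := by
        rw [abs_of_nonneg (by nlinarith [sq_nonneg (1 - B)])]
        nlinarith [sq_nonneg t]
      exact h4.trans (mul_le_mul_of_nonneg_left h6 (Finset.prod_nonneg fun i _ => abs_nonneg _))
    have h := Real.log_nonneg h3
    rwa [Real.log_mul (Finset.prod_ne_zero_iff.mpr fun i _ => abs_ne_zero.mpr (ha1 i))
      (by positivity), Real.log_prod (fun i _ => abs_ne_zero.mpr (ha1 i)), Real.log_pow] at h
  have hr := fun i => weighted_log_real_le (hx i) (fun h => ha1 i (by rw [h, sub_self]))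
  have hc := weighted_log_complex_le hB
  simp only [Fin.sum_univ_four] at *
  have := hr 0
  have := hr 1
  have := hr 2
  have := hr 3
  linarith

theorem one_le_abs_intCast {n : ℤ} (hn : n ≠ 0) : (1 : ℝ) ≤ |(n : ℝ)| := by
  exact_mod_cast Int.one_le_abs hn

open scoped Classical in
theorem sum_sq_eq_card_of_eq_one_or_neg_one {K : Type*} [Field K] [NumberField K] {α : 𝓞 K}
    (h : α = 1 ∨ α = -1) :
    ∑ w : InfinitePlace K, w α ^ 2 = Fintype.card (InfinitePlace K) := by
  have hw : ∀ w : InfinitePlace K, w α = 1 := fun w => by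
    rw [← norm_embedding_eq]
    rcases h with rfl | rfl <;> simp
  simp [hw]

theorem normalizedMin_eq_one_of_signature_four_one (K : Type*) [Field K] [NumberField K]
    (hK : HasSignature K 4 1) : normalizedMin K = 1 := by
  classical
  have hcard : (Fintype.card (InfinitePlace K) : ℝ) = 5 := by
    rw [card_eq_nrRealPlaces_add_nrComplexPlaces, hK.1, hK.2]
    norm_num
  have hpm : ∀ α : 𝓞 K, α = 1 ∨ α = -1 → ∑ w : InfinitePlace K, w α ^ 2 = 5 := by
    intro α h
    rw [sum_sq_eq_card_of_eq_one_or_neg_one h, hcard]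
  have hle := minDistance_sq_le (1 : 𝓞 K) one_ne_zero
  rw [hpm 1 (Or.inl rfl)] at hle
  have hge : 5 ≤ minDistance K ^ 2 := by
    refine le_minDistance_sq fun α hα => ?_
    by_cases hα1 : α = 1 ∨ α = -1
    · rw [hpm α hα1]
    push Not at hα1
    obtain ⟨a, t, B, P, ht, hP, hsum, hne⟩ := exists_charpoly_of_hasSignature hK α
    have hev : ∀ k : ℤ, α ≠ k →
        1 ≤ |(∏ i, ((k : ℝ) - a i)) * ((k : ℝ) ^ 2 - t 0 * k + B 0)| := fun k hk => by
      have h := congrArg (Polynomial.eval (k : ℝ)) hP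
      rw [Polynomial.eval_intCast_map, eval_mul, eval_prod, eval_prod] at h
      simp only [eval_sub, eval_add, eval_mul, eval_pow, eval_X, eval_C, Fin.prod_univ_one,
        eq_intCast, Int.cast_id] at h
      rw [← h]
      exact one_le_abs_intCast fun h0 => hk (hne k h0)
    rw [hsum, Fin.sum_univ_one]
    refine five_le_sum_sq_of_signature_four_one a (t 0) (B 0) (ht 0) ?_ ?_ ?_
    · have := hev 0 (by simpa using hα)
      simpa [Finset.prod_neg] using this
    · have := hev 1 (by simpa using hα1.1)
      simpa using this
    · have := hev (-1) (by simpa using hα1.2)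
      convert this using 3 <;> push_cast <;> ring
  rw [normalizedMin, hK.1, hK.2, le_antisymm hle hge]
  norm_num

/-! ### Signature (2,2): numerical bounds -/

theorem root_bounds {v₀ : ℝ} (hv₀ : 0 < v₀) (h₀ : v₀ ^ 6 + v₀ ^ 2 = 1) :
    0.82603 < v₀ ∧ v₀ ^ 2 < 0.68233 ∧ 3.785868 < 2 * v₀ ^ 2 + 2 / v₀ ∧ 2 * v₀ ^ 2 + 2 / v₀ < 3.785872 := by
  have a1 : v₀ < 0.8260314 := by
    by_contra! hc
    have : (0.8260314 : ℝ) ^ 6 ≤ v₀ ^ 6 := by gcongr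
    have : (0.8260314 : ℝ) ^ 2 ≤ v₀ ^ 2 := by gcongr
    norm_num at *
    linarith
  have a2 : 0.8260313 < v₀ := by
    by_contra! hc
    have : v₀ ^ 6 ≤ (0.8260313 : ℝ) ^ 6 := by gcongr
    have : v₀ ^ 2 ≤ (0.8260313 : ℝ) ^ 2 := by gcongr
    norm_num at *
    linarith
  obtain ⟨w₀, hw₀⟩ : ∃ w₀, w₀ = 1 / v₀ := ⟨_, rfl⟩
  have hvw₀ : v₀ * w₀ = 1 := by rw [hw₀]; field_simp
  have hf : 2 / v₀ = 2 * w₀ := by rw [hw₀]; ring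
  rw [hf]
  have hw1 : w₀ < 1.210608 := by nlinarith
  have hw2 : 1.2106075 < w₀ := by nlinarith
  exact ⟨by linarith, by nlinarith, by nlinarith, by nlinarith⟩

/-- The function `v² + 1/v` has its minimum at `2 ^ (-1/3) ≈ 0.794`, just below `v₀ ≈ 0.826`, so a
value below that at `v₀` confines `v` to a short interval and leaves little room for the defect `e`.
-/
theorem mean_bounds {v w v₀ e : ℝ} (hv : 0 < v) (hvw : v * w = 1) (hv₀ : 0 < v₀)
    (h₀ : v₀ ^ 6 + v₀ ^ 2 = 1) (he : 0 ≤ e) (h : e + 2 * v ^ 2 + 2 * w < 2 * v₀ ^ 2 + 2 / v₀) :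
    v < v₀ ∧ 0.5806 < v ^ 2 ∧ e < 0.0063 := by
  obtain ⟨hv₀1, hv₀2, -, hf₀⟩ := root_bounds hv₀ h₀
  have hw : 0 < w := pos_of_mul_pos_right (hvw ▸ one_pos) hv.le
  obtain ⟨w₀, hw₀⟩ : ∃ w₀, w₀ = 1 / v₀ := ⟨_, rfl⟩
  have hvw₀ : v₀ * w₀ = 1 := by rw [hw₀]; field_simp
  have hw₀0 : 0 < w₀ := by rw [hw₀]; positivity
  have hf : 2 / v₀ = 2 * w₀ := by rw [hw₀]; ring
  rw [hf] at h hf₀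
  refine ⟨?_, ?_, ?_⟩
  · by_contra! hc
    have h1 : w ≤ w₀ := by nlinarith
    -- The second factor is positive for `v ≥ v₀`, so the function increases there.
    have h2 : v ^ 2 + w - v₀ ^ 2 - w₀ = (v - v₀) * (v + v₀ - w * w₀) := by
      linear_combination w₀ * hvw - w * hvw₀
    have h3 : w * w₀ ≤ w₀ * w₀ := by gcongr
    have hw₀1 : w₀ < 1.211 := by nlinarith
    have h5 : w₀ * w₀ < 1.211 * 1.211 := mul_lt_mul'' hw₀1 hw₀1 hw₀0.le hw₀0.le
    have h4 : 0 ≤ (v - v₀) * (v + v₀ - w * w₀) := mul_nonneg (by linarith) (by linarith)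
    linarith
  · have hv1 : 0.762 < v := by
      by_contra! hc
      have h5 : v ^ 3 + 1 < 1.892936 * v := by
        have : v * (v ^ 2 + w) < v * 1.892936 := by
          apply mul_lt_mul_of_pos_left _ hv
          linarith
        nlinarith
      -- The hint is the tangent-line bound for `v³` at `0.762`.
      nlinarith [mul_nonneg (sq_nonneg (v - 0.762)) (by linarith : 0 ≤ v + 1.524)]
    nlinarith
  · have h6 : 27 ≤ 4 * (v ^ 2 + w) ^ 3 := by
      have h7 : v ^ 2 * w ^ 2 = 1 := by rw [← mul_pow, hvw, one_pow]
      have h8 : 0 ≤ (2 * v ^ 2 - w) ^ 2 * (v ^ 2 + 4 * w) := by positivity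
      nlinarith
    have h9 : 1.8898 < v ^ 2 + w := by
      by_contra! hc
      have : (v ^ 2 + w) ^ 3 ≤ 1.8898 ^ 3 := by gcongr
      norm_num at this
      linarith
    linarith

/-! ### Signature (2,2): real roots of opposite sign, with `u = -a₁a₂` and `ε = a₁ + a₂` -/

section

variable {u w ε t₁ t₂ b₁ b₂ : ℝ}

/-- The estimates on the complex roots shared by the cases below. -/
theorem complex_bounds (hu1 : 0.5806 < u) (hu2 : u < 0.68233) (hw : 0 < w) (huw : u * w ^ 2 = 1)
    (hb : b₁ * b₂ = w) (he : ε ^ 2 + (b₁ - b₂) ^ 2 < 0.0063)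
    (hs : ε ^ 2 + 2 * u + (b₁ ^ 2 + b₂ ^ 2) < 3.785872) :
    |ε| < 0.0794 ∧ 2.42 < b₁ ^ 2 + b₂ ^ 2 ∧ b₁ ^ 2 + b₂ ^ 2 < 3.785872 - 2 * u ∧
      |b₁ ^ 2 - b₂ ^ 2| < 0.182 ∧ 1.4655 < w ^ 2 ∧ w ^ 2 < 1.7224 := by
  have hD1 : 1.4655 < w ^ 2 := by nlinarith
  have hD2 : w ^ 2 < 1.7224 := by nlinarith
  have hw1 : 1.21 < w := by nlinarith
  have hw2 : w < 1.3125 := by nlinarith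
  have hss : b₁ ^ 2 + b₂ ^ 2 = (b₁ - b₂) ^ 2 + 2 * w := by rw [← hb]; ring
  refine ⟨?_, by nlinarith [sq_nonneg (b₁ - b₂)], by nlinarith [sq_nonneg ε], ?_, hD1, hD2⟩
  · apply abs_lt_of_sq_lt_sq _ (by norm_num)
    nlinarith [sq_nonneg (b₁ - b₂)]
  · apply abs_lt_of_sq_lt_sq _ (by norm_num)
    have h1 : (b₁ ^ 2 - b₂ ^ 2) ^ 2 = (b₁ - b₂) ^ 2 * ((b₁ - b₂) ^ 2 + 4 * w) := by
      rw [← hb]; ring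
    rw [h1]
    have h2 : (b₁ - b₂) ^ 2 < 0.0063 := by nlinarith [sq_nonneg ε]
    have h3 : (b₁ - b₂) ^ 2 + 4 * w < 5.2563 := by linarith
    calc (b₁ - b₂) ^ 2 * ((b₁ - b₂) ^ 2 + 4 * w) ≤ 0.0063 * 5.2563 := by gcongr
      _ < 0.182 ^ 2 := by norm_num

/-- A lower bound for the norm of `1 - α` bounds the distance between the complex roots. -/
theorem sq_sub_le_of_one_le (hq : 1 - ε - u < 0.4988) (hq0 : 0 < 1 - ε - u)
    (hP : 1 ≤ (1 - ε - u) * ((1 + b₁ ^ 2 - t₁) * (1 + b₂ ^ 2 - t₂))) :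
    ((b₁ ^ 2 - b₂ ^ 2) - (t₁ - t₂)) ^ 2 + 8.019 ≤ (2 + (b₁ ^ 2 + b₂ ^ 2) - (t₁ + t₂)) ^ 2 := by
  have h1 : 4 * ((1 + b₁ ^ 2 - t₁) * (1 + b₂ ^ 2 - t₂)) =
      (2 + (b₁ ^ 2 + b₂ ^ 2) - (t₁ + t₂)) ^ 2 - ((b₁ ^ 2 - b₂ ^ 2) - (t₁ - t₂)) ^ 2 := by ring
  have h2 : 0 < (1 + b₁ ^ 2 - t₁) * (1 + b₂ ^ 2 - t₂) := by
    by_contra! hc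
    nlinarith
  -- The bound `0.4988 = 1 + 0.0794 - 0.5806` comes from `|ε| < 0.0794` and `u > 0.5806`.
  have h3 : 1 ≤ 0.4988 * ((1 + b₁ ^ 2 - t₁) * (1 + b₂ ^ 2 - t₂)) := hP.trans (by gcongr)
  linarith

theorem trace_lt_two (hu1 : 0.5806 < u) (hu2 : u < 0.68233) (hw : 0 < w) (huw : u * w ^ 2 = 1)
    (hb : b₁ * b₂ = w) (he : ε ^ 2 + (b₁ - b₂) ^ 2 < 0.0063)
    (hs : ε ^ 2 + 2 * u + (b₁ ^ 2 + b₂ ^ 2) < 3.785872)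
    (hx : 0 ≤ 2 + (b₁ ^ 2 + b₂ ^ 2) - (t₁ + t₂))
    (hP : 1 ≤ (1 - ε - u) * ((1 + b₁ ^ 2 - t₁) * (1 + b₂ ^ 2 - t₂))) : t₁ + t₂ + ε < 2 := by
  obtain ⟨h1, h2, h3, h4, h5, h6⟩ := complex_bounds hu1 hu2 hw huw hb he hs
  rw [abs_lt] at h1
  have h7 := sq_sub_le_of_one_le (by linarith) (by linarith) hP
  by_contra! hc
  have h8 : 2 + (b₁ ^ 2 + b₂ ^ 2) - (t₁ + t₂) ≤ 2.71 := by linarith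
  have h9 : (2 + (b₁ ^ 2 + b₂ ^ 2) - (t₁ + t₂)) ^ 2 ≤ 2.71 ^ 2 := by gcongr
  nlinarith [sq_nonneg ((b₁ ^ 2 - b₂ ^ 2) - (t₁ - t₂))]

theorem abs_mul_lt_of_abs_lt {x y p q : ℝ} (hx : |x| < p) (hy : |y| < q) : |x * y| < p * q := by
  rw [abs_mul]
  exact mul_lt_mul'' hx hy (abs_nonneg _) (abs_nonneg _)

theorem mul_bounds {x y a b c d : ℝ} (ha : 0 ≤ a) (hc : 0 ≤ c) (hax : a < x) (hxb : x < b)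
    (hcy : c < y) (hyd : y < d) : a * c < x * y ∧ x * y < b * d :=
  ⟨mul_lt_mul'' hax hcy ha hc, mul_lt_mul'' hxb hyd (ha.trans hax.le) (hc.trans hcy.le)⟩

/-- For `ε ≥ 0`, `hfin` bounds `D + u = D + 1/D` below its value at `D = 1.4655`. For `ε < 0`, `hE`
gives `D > 1 + 1/D`, so `D` exceeds the golden ratio, and `hE` also bounds `-ε` in terms of `D - 1 -
u`, too small to rescue `hfin`. -/
theorem trace_one_inequality_false {u ε D s V : ℝ} (hu1 : 0.5806 < u) (hu2 : u < 0.68233)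
    (huw : u * D = 1) (hD1 : 1.4655 < D) (hD2 : D < 1.7224) (hD2' : D ^ 2 < 2.967)
    (hs1 : 2.42 < s) (hs2 : s < 3.785872 - 2 * u) (hV1 : 0.97 < V)
    (hE : -1 = u - D - ε * (D ^ 2 + V + u))
    (hfin : 2 * D + ε * (2 * D ^ 2 + s) - s < 0.4682) : False := by
  rcases le_or_gt 0 ε with h0 | h0
  · have h1 : 0 ≤ ε * (2 * D ^ 2 + s) := mul_nonneg h0 (by positivity)
    have h2 : 0 < (D - 1.4655) * (1.4655 - u) := mul_pos (by linarith) (by linarith)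
    linarith
  · have h1 : 0 < -ε * (D ^ 2 + V + u) := mul_pos (by linarith) (by positivity)
    have h2 : 1.61 < D := by
      by_contra! hc
      have h3 : 0 < D * (D - 1 - u) := mul_pos (by linarith) (by linarith)
      have h4 : 0 ≤ (1.61 - D) * (D + 0.6) := mul_nonneg (by linarith) (by linarith)
      linarith
    have h3 : 1.61 * 1.61 < D * D := mul_lt_mul'' h2 h2 (by norm_num) (by norm_num)
    have h4 : -ε * 4.14 ≤ -ε * (D ^ 2 + V + u) :=
      mul_le_mul_of_nonneg_left (by linarith) (by linarith)
    have h5 : -ε * (2 * D ^ 2 + s) ≤ -ε * 8.56 :=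
      mul_le_mul_of_nonneg_left (by linarith) (by linarith)
    linarith

/-- The polynomial is `(X² - εX - u)(X⁴ - (t₁+t₂)X³ + VX² - SX + D)`. With trace 1, the norm of `1 -
α` bounds `t₁ - t₂`. All quantities are then known closely enough to pin the integers `c₁ = 1` and
`c₃ = -1`, and these two equations are incompatible with the size bounds. -/
theorem trace_ne_one (hu1 : 0.5806 < u) (hu2 : u < 0.68233) (hw : 0 < w) (huw : u * w ^ 2 = 1)
    (hb : b₁ * b₂ = w) (he : ε ^ 2 + (b₁ - b₂) ^ 2 < 0.0063)
    (hs : ε ^ 2 + 2 * u + (b₁ ^ 2 + b₂ ^ 2) < 3.785872)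
    (hP : 1 ≤ (1 - ε - u) * ((1 + b₁ ^ 2 - t₁) * (1 + b₂ ^ 2 - t₂))) (c₁ c₃ : ℤ)
    (hc₁ : c₁ = u * (t₁ * b₂ ^ 2 + t₂ * b₁ ^ 2) - ε * w ^ 2)
    (hc₃ : c₃ = -(t₁ * b₂ ^ 2 + t₂ * b₁ ^ 2) - ε * (b₁ ^ 2 + b₂ ^ 2 + t₁ * t₂) + u * (t₁ + t₂)) :
    t₁ + t₂ + ε ≠ 1 := by
  intro hT
  obtain ⟨hε, hs1, hs2, hg, hD1, hD2⟩ := complex_bounds hu1 hu2 hw huw hb he hs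
  have hε' := abs_lt.mp hε
  have hd := sq_sub_le_of_one_le (by linarith) (by linarith) hP
  obtain ⟨D, hD⟩ : ∃ D, D = w ^ 2 := ⟨_, rfl⟩
  obtain ⟨s, hsd⟩ : ∃ s, s = b₁ ^ 2 + b₂ ^ 2 := ⟨_, rfl⟩
  obtain ⟨S, hS⟩ : ∃ S, S = t₁ * b₂ ^ 2 + t₂ * b₁ ^ 2 := ⟨_, rfl⟩
  obtain ⟨V, hV⟩ : ∃ V, V = s + t₁ * t₂ := ⟨_, rfl⟩
  have hSR : 2 * S = s * (t₁ + t₂) - (b₁ ^ 2 - b₂ ^ 2) * (t₁ - t₂) := by rw [hS, hsd]; ring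
  have hVd : V = s + ((t₁ + t₂) ^ 2 - (t₁ - t₂) ^ 2) / 4 := by rw [hV]; ring
  have hT' : t₁ + t₂ = 1 - ε := by linarith
  rw [← hsd, ← hV, ← hS, hT'] at hc₃
  rw [← hS, ← hD] at hc₁
  rw [← hD] at hD1 hD2 huw
  rw [← hsd] at hs1 hs2 hd
  rw [hT'] at hSR hVd hd
  have hgd : |(b₁ ^ 2 - b₂ ^ 2) - (t₁ - t₂)| < 2.39 := by
    apply abs_lt_of_sq_lt_sq _ (by norm_num)
    have : (2 + s - (1 - ε)) ^ 2 < 3.7042 ^ 2 := by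
      apply pow_lt_pow_left₀ <;> linarith
    linarith
  have hdd : |t₁ - t₂| < 2.572 := by
    rw [abs_lt] at *
    constructor <;> linarith
  have hR := abs_lt.mp (abs_mul_lt_of_abs_lt hg hdd)
  have hd2 : (t₁ - t₂) ^ 2 < 2.572 ^ 2 := by
    rw [← sq_abs]
    gcongr
  clear hd hgd hdd hg hb hP hs he hw
  have hsT := mul_bounds (by norm_num) (by norm_num) hs1 (by linarith : s < 2.6247)
    (by linarith : 0.9206 < 1 - ε) (by linarith : 1 - ε < 1.0794)
  have hTT := mul_bounds (by norm_num) (by norm_num) (by linarith : 0.9206 < 1 - ε)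
    (by linarith : 1 - ε < 1.0794) (by linarith : 0.9206 < 1 - ε) (by linarith : 1 - ε < 1.0794)
  have hS1 : 0.87 < S := by linarith
  have hS2 : S < 1.655 := by linarith
  have hV1 : 0.97 < V := by linarith
  have hV2 : V < 2.92 := by linarith [sq_nonneg (t₁ - t₂)]
  have huS := mul_bounds (by norm_num) (by norm_num) hu1 hu2 hS1 hS2
  have hDD := mul_bounds (by norm_num) (by norm_num) hD1 hD2 hD1 hD2
  have hεD := abs_lt.mp (abs_mul_lt_of_abs_lt hε (abs_lt.mpr ⟨by linarith, hD2⟩ : |D| < 1.7224))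
  have hc₁1 : c₁ = 1 := by
    have h1 : (0 : ℝ) < c₁ := by rw [hc₁]; linarith
    have h2 : (c₁ : ℝ) < 2 := by rw [hc₁]; linarith
    have h1' : 0 < c₁ := by exact_mod_cast h1
    have h2' : c₁ < 2 := by exact_mod_cast h2
    omega
  rw [hc₁1, Int.cast_one] at hc₁
  -- Multiply the equation for `c₁` by `D` and use `uD = 1`.
  have hSD : S = D + ε * D ^ 2 := by linear_combination (-D) * hc₁ - S * huw
  have hc₃e : (c₃ : ℝ) = u - D - ε * (D ^ 2 + V + u) := by rw [hc₃, hSD]; ring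
  have hD2' : D ^ 2 < 2.967 := by linarith
  have hεE := abs_lt.mp (abs_mul_lt_of_abs_lt hε
    (abs_lt.mpr ⟨by linarith [sq_nonneg D], by linarith⟩ : |D ^ 2 + V + u| < 6.57))
  have hc₃1 : c₃ = -1 := by
    have h1 : (-2 : ℝ) < c₃ := by rw [hc₃e]; linarith
    have h2 : (c₃ : ℝ) < 0 := by rw [hc₃e]; linarith
    have h1' : -2 < c₃ := by exact_mod_cast h1
    have h2' : c₃ < 0 := by exact_mod_cast h2
    omega
  rw [hc₃1] at hc₃e
  push_cast at hc₃e
  have hfin : 2 * D + ε * (2 * D ^ 2 + s) - s < 0.4682 := by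
    have : 2 * D + ε * (2 * D ^ 2 + s) - s = 2 * S - s * (1 - ε) := by rw [hSD]; ring
    rw [this, hSR]
    linarith
  exact trace_one_inequality_false hu1 hu2 huw hD1 hD2 (by linarith) hs1 (by linarith) hV1 hc₃e hfin

/-- Here `u` is a root of `y³ + c₄y² + c₂y - 1`, so `c₂ = 1/u - c₄u - u²`. For each of the five
possible `c₄` this lies strictly between consecutive integers. For `c₄ = 0` it would equal 1 at `u =
u₀`, the extremal polynomial, and `u < u₀` pushes it above 1. -/
theorem trinomial_coeff_false {u u₀ D V : ℝ} (hu1 : 0.5806 < u) (hu₀ : u < u₀) (hu2 : u₀ < 0.68233)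
    (hu₀3 : u₀ ^ 3 + u₀ = 1) (huw : u * D = 1) (hD1 : 1.4655 < D) (hD2 : D < 1.7224)
    (hV1 : -1.47 < V) (hV2 : V < 3.785872 - 2 * u) (c₂ c₄ : ℤ) (hc₄ : c₄ = V - u)
    (hc₂ : c₂ = D - u * V) : False := by
  have hu2' : u < 0.68233 := hu₀.trans hu2
  have hVe : V = c₄ + u := by linarith
  have hc₂e : (c₂ : ℝ) = D - u * (c₄ + u) := by rw [hc₂, hVe]
  have h4l : -3 < c₄ := by
    have : (-3 : ℝ) < c₄ := by linarith
    exact_mod_cast this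
  have h4u : c₄ < 3 := by
    have : (c₄ : ℝ) < 3 := by linarith
    exact_mod_cast this
  have huu := mul_bounds (by norm_num) (by norm_num) hu1 hu2' hu1 hu2'
  have hu21 : 0.337 < u ^ 2 := by linarith
  have hu22 : u ^ 2 < 0.4656 := by linarith
  have key : ∀ n : ℤ, (n : ℝ) < c₂ → (c₂ : ℝ) < n + 1 → False := fun n h1 h2 => by
    have h1' : n < c₂ := by exact_mod_cast h1
    have h2' : c₂ < n + 1 := by exact_mod_cast h2
    omega
  have hcases : c₄ = -2 ∨ c₄ = -1 ∨ c₄ = 0 ∨ c₄ = 1 ∨ c₄ = 2 := by omega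
  rcases hcases with rfl | rfl | rfl | rfl | rfl
  · refine key 2 ?_ ?_ <;> rw [hc₂e] <;> push_cast <;> linarith
  · have h1 : 0 ≤ (u - 0.5806) * (D - 0.5806) := mul_nonneg (by linarith) (by linarith)
    have h2 : D + u < 2.3031 := by linarith
    refine key 1 ?_ ?_ <;> rw [hc₂e] <;> push_cast <;> linarith
  · have h3 : 1 < D - u ^ 2 := by
      have h1 : u ^ 3 < u₀ ^ 3 := by gcongr
      have h2 : 0 < u * (D - u ^ 2 - 1) := by linarith
      have := pos_of_mul_pos_right h2 (by linarith)
      linarith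
    refine key 1 ?_ ?_ <;> rw [hc₂e] <;> push_cast <;> linarith
  · refine key 0 ?_ ?_ <;> rw [hc₂e] <;> push_cast <;> linarith
  · push_cast at hVe
    have h1 : u < 0.5954 := by linarith
    have h2 : 1.679 < D := by
      by_contra! hc
      have : u * D ≤ 0.5954 * 1.679 := mul_le_mul h1.le hc (by linarith) (by norm_num)
      norm_num at this
      linarith
    refine key 0 ?_ ?_ <;> rw [hc₂e] <;> push_cast <;> linarith

/-- As for trace 1, but now `c₁ = c₃ = 0`. Since `c₃` is `-ε` times a positive number, `ε = 0`;
hence also `S = 0` and the polynomial is even. -/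
theorem trace_ne_zero {u₀ : ℝ} (hu1 : 0.5806 < u) (hu₀ : u < u₀) (hu2 : u₀ < 0.68233)
    (hu₀3 : u₀ ^ 3 + u₀ = 1) (hw : 0 < w) (huw : u * w ^ 2 = 1)
    (hb : b₁ * b₂ = w) (he : ε ^ 2 + (b₁ - b₂) ^ 2 < 0.0063)
    (hs : ε ^ 2 + 2 * u + (b₁ ^ 2 + b₂ ^ 2) < 3.785872)
    (hP : 1 ≤ (1 - ε - u) * ((1 + b₁ ^ 2 - t₁) * (1 + b₂ ^ 2 - t₂))) (c₁ c₂ c₃ c₄ : ℤ)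
    (hc₁ : c₁ = u * (t₁ * b₂ ^ 2 + t₂ * b₁ ^ 2) - ε * w ^ 2)
    (hc₂ : c₂ = w ^ 2 + ε * (t₁ * b₂ ^ 2 + t₂ * b₁ ^ 2) - u * (b₁ ^ 2 + b₂ ^ 2 + t₁ * t₂))
    (hc₃ : c₃ = -(t₁ * b₂ ^ 2 + t₂ * b₁ ^ 2) - ε * (b₁ ^ 2 + b₂ ^ 2 + t₁ * t₂) + u * (t₁ + t₂))
    (hc₄ : c₄ = b₁ ^ 2 + b₂ ^ 2 + t₁ * t₂ + ε * (t₁ + t₂) - u) :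
    t₁ + t₂ + ε ≠ 0 := by
  intro hT
  have hu2' : u < 0.68233 := hu₀.trans hu2
  obtain ⟨hε, hs1, hs2, hg, hD1, hD2⟩ := complex_bounds hu1 hu2' hw huw hb he hs
  have hε' := abs_lt.mp hε
  have hd := sq_sub_le_of_one_le (by linarith) (by linarith) hP
  obtain ⟨D, hD⟩ : ∃ D, D = w ^ 2 := ⟨_, rfl⟩
  obtain ⟨s, hsd⟩ : ∃ s, s = b₁ ^ 2 + b₂ ^ 2 := ⟨_, rfl⟩
  obtain ⟨S, hS⟩ : ∃ S, S = t₁ * b₂ ^ 2 + t₂ * b₁ ^ 2 := ⟨_, rfl⟩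
  obtain ⟨V, hV⟩ : ∃ V, V = s + t₁ * t₂ := ⟨_, rfl⟩
  have hSR : 2 * S = s * (t₁ + t₂) - (b₁ ^ 2 - b₂ ^ 2) * (t₁ - t₂) := by rw [hS, hsd]; ring
  have hVd : V = s + ((t₁ + t₂) ^ 2 - (t₁ - t₂) ^ 2) / 4 := by rw [hV]; ring
  have hT' : t₁ + t₂ = -ε := by linarith
  rw [← hsd, ← hV, ← hS, hT'] at hc₃
  rw [← hsd, ← hV, hT'] at hc₄
  rw [← hsd, ← hV, ← hS, ← hD] at hc₂
  rw [← hS, ← hD] at hc₁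
  rw [← hD] at hD1 hD2 huw
  rw [← hsd] at hs1 hs2 hd
  rw [hT'] at hSR hVd hd
  have hgd : |(b₁ ^ 2 - b₂ ^ 2) - (t₁ - t₂)| < 3.757 := by
    apply abs_lt_of_sq_lt_sq _ (by norm_num)
    have : (2 + s - -ε) ^ 2 < 4.7042 ^ 2 := by
      apply pow_lt_pow_left₀ <;> linarith
    linarith
  have hdd : |t₁ - t₂| < 3.94 := by
    rw [abs_lt] at *
    constructor <;> linarith
  have hR := abs_lt.mp (abs_mul_lt_of_abs_lt hg hdd)
  have hd2 : (t₁ - t₂) ^ 2 < 3.94 ^ 2 := by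
    rw [← sq_abs]
    gcongr
  have hε2 : ε ^ 2 < 0.0063 := by linarith [sq_nonneg (b₁ - b₂)]
  clear hd hgd hdd hg hb hP hs he hw
  have hsε := abs_lt.mp (abs_mul_lt_of_abs_lt hε (abs_lt.mpr ⟨by linarith, by linarith⟩ : |s| < 2.63))
  have hS' : |S| < 0.47 := by
    rw [abs_lt]
    constructor <;> linarith
  have hV1 : -1.47 < V := by linarith [sq_nonneg ε]
  have hV2 : V < 2.63 := by linarith [sq_nonneg (t₁ - t₂)]
  have hDD := mul_bounds (by norm_num) (by norm_num) hD1 hD2 hD1 hD2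
  have hεD := abs_lt.mp (abs_mul_lt_of_abs_lt hε (abs_lt.mpr ⟨by linarith, hD2⟩ : |D| < 1.7224))
  have huS := abs_lt.mp (abs_mul_lt_of_abs_lt (abs_lt.mpr ⟨by linarith, hu2'⟩ : |u| < 0.68233) hS')
  have hc₁0 : c₁ = 0 := by
    have h1 : (-1 : ℝ) < c₁ := by rw [hc₁]; linarith
    have h2 : (c₁ : ℝ) < 1 := by rw [hc₁]; linarith
    have h1' : -1 < c₁ := by exact_mod_cast h1
    have h2' : c₁ < 1 := by exact_mod_cast h2
    omega
  rw [hc₁0, Int.cast_zero] at hc₁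
  have hSD : S = ε * D ^ 2 := by linear_combination (-D) * hc₁ - S * huw
  have hc₃e : (c₃ : ℝ) = - (ε * (D ^ 2 + V + u)) := by rw [hc₃, hSD]; ring
  have hD2' : D ^ 2 < 2.967 := by linarith
  have hE : 0 < D ^ 2 + V + u := by linarith
  have hεE := abs_lt.mp (abs_mul_lt_of_abs_lt hε
    (abs_lt.mpr ⟨by linarith, by linarith⟩ : |D ^ 2 + V + u| < 6.57))
  have hc₃0 : c₃ = 0 := by
    have h1 : (-1 : ℝ) < c₃ := by rw [hc₃e]; linarith
    have h2 : (c₃ : ℝ) < 1 := by rw [hc₃e]; linarith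
    have h1' : -1 < c₃ := by exact_mod_cast h1
    have h2' : c₃ < 1 := by exact_mod_cast h2
    omega
  rw [hc₃0, Int.cast_zero] at hc₃e
  have hε0 : ε = 0 := by
    rcases mul_eq_zero.mp (neg_eq_zero.mp hc₃e.symm) with h | h
    · exact h
    · exact absurd h hE.ne'
  subst hε0
  have hVs : V ≤ s := by linarith [sq_nonneg (t₁ - t₂)]
  exact trinomial_coeff_false hu1 hu₀ hu2 hu₀3 huw hD1 hD2 hV1 (by linarith) c₂ c₄ (by linarith) (by linarith)

end

/-- The real roots nearly coincide, so the real part of the norm of `1 - α` is about `(1 - v)²`, at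
most `0.2381²`. The complex part must compensate, which needs `T` very negative; the norm of `1 + α`
then leaves too little room, since `4 + 2s < 9.25 < 8.39 + 1.09`. -/
theorem real_roots_not_same_sign {A v b₁ b₂ t₁ t₂ : ℝ} (hA0 : 0 ≤ A) (hA1 : 4 * v ^ 2 ≤ A ^ 2)
    (hA2 : A ^ 2 < 4 * v ^ 2 + 0.0063) (hv : 0 < v) (hv1 : 0.5806 < v ^ 2) (hv2 : v ^ 2 < 0.68233)
    (hs : 2 * v ^ 2 + (b₁ ^ 2 + b₂ ^ 2) < 3.785872)
    (hx : 0 ≤ 2 + (b₁ ^ 2 + b₂ ^ 2) - (t₁ + t₂)) (hy : 0 ≤ 2 + (b₁ ^ 2 + b₂ ^ 2) + (t₁ + t₂))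
    (hP : 1 ≤ |(1 - A + v ^ 2) * ((1 + b₁ ^ 2 - t₁) * (1 + b₂ ^ 2 - t₂))|)
    (hQ : 1 ≤ |(1 + A + v ^ 2) * ((1 + b₁ ^ 2 + t₁) * (1 + b₂ ^ 2 + t₂))|)
    (hX : 0 ≤ (1 + b₁ ^ 2 - t₁) * (1 + b₂ ^ 2 - t₂))
    (hY : 0 ≤ (1 + b₁ ^ 2 + t₁) * (1 + b₂ ^ 2 + t₂)) : False := by
  have hv3 : 0.7619 < v := by nlinarith
  have hv4 : v < 0.82604 := by nlinarith
  have hA3 : 2 * v ≤ A := by nlinarith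
  have hA4 : A < 2 * v + 0.0031 := by nlinarith
  have hX4 : 4 * ((1 + b₁ ^ 2 - t₁) * (1 + b₂ ^ 2 - t₂)) ≤
      (2 + (b₁ ^ 2 + b₂ ^ 2) - (t₁ + t₂)) ^ 2 := by
    linarith [sq_nonneg ((1 + b₁ ^ 2 - t₁) - (1 + b₂ ^ 2 - t₂))]
  have hY4 : 4 * ((1 + b₁ ^ 2 + t₁) * (1 + b₂ ^ 2 + t₂)) ≤
      (2 + (b₁ ^ 2 + b₂ ^ 2) + (t₁ + t₂)) ^ 2 := by
    linarith [sq_nonneg ((1 + b₁ ^ 2 + t₁) - (1 + b₂ ^ 2 + t₂))]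
  generalize (1 + b₁ ^ 2 - t₁) * (1 + b₂ ^ 2 - t₂) = x at *
  generalize (1 + b₁ ^ 2 + t₁) * (1 + b₂ ^ 2 + t₂) = y at *
  generalize b₁ ^ 2 + b₂ ^ 2 = s at *
  generalize t₁ + t₂ = T at *
  have hp : |1 - A + v ^ 2| ≤ 0.2381 ^ 2 := by
    rw [abs_le]
    constructor <;> nlinarith
  have hq : |1 + A + v ^ 2| ≤ 3.35 := by
    rw [abs_le]
    constructor <;> nlinarith
  rw [abs_mul, abs_of_nonneg hX] at hP
  rw [abs_mul, abs_of_nonneg hY] at hQ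
  have h1 : 1 ≤ 0.2381 ^ 2 * x := hP.trans (by gcongr)
  have h2 : 1 ≤ 3.35 * y := hQ.trans (by gcongr)
  have h3 : 8.39 < 2 + s - T := lt_of_pow_lt_pow_left₀ 2 hx (by linarith)
  have h4 : 1.09 < 2 + s + T := lt_of_pow_lt_pow_left₀ 2 hy (by linarith)
  linarith

/-! ### Signature (2,2): the lower bound -/

/-- The lower bound for monic sextic polynomials with two real roots and integral coefficients which
do not vanish at `0`, `1` and `-1`. -/
theorem le_sum_sq_roots {v₀ a₁ a₂ t₁ t₂ B₁ B₂ : ℝ} (hv₀ : 0 < v₀) (h₀ : v₀ ^ 6 + v₀ ^ 2 = 1)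
    (ht₁ : t₁ ^ 2 ≤ 4 * B₁) (ht₂ : t₂ ^ 2 ≤ 4 * B₂) (c₀ c₁ c₂ c₃ c₄ c₅ : ℤ)
    (hc₅ : c₅ = -((a₁ + a₂) + (t₁ + t₂)))
    (hc₄ : c₄ = B₁ + B₂ + t₁ * t₂ + (a₁ + a₂) * (t₁ + t₂) + a₁ * a₂)
    (hc₃ : c₃ = -(t₁ * B₂ + t₂ * B₁) - (a₁ + a₂) * (B₁ + B₂ + t₁ * t₂) - a₁ * a₂ * (t₁ + t₂))
    (hc₂ : c₂ = B₁ * B₂ + (a₁ + a₂) * (t₁ * B₂ + t₂ * B₁) + a₁ * a₂ * (B₁ + B₂ + t₁ * t₂))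
    (hc₁ : c₁ = -(a₁ + a₂) * (B₁ * B₂) - a₁ * a₂ * (t₁ * B₂ + t₂ * B₁))
    (hc₀ : c₀ = a₁ * a₂ * (B₁ * B₂)) (hP₀ : c₀ ≠ 0)
    (hP₁ : 1 + c₅ + c₄ + c₃ + c₂ + c₁ + c₀ ≠ 0) (hP₂ : 1 - c₅ + c₄ - c₃ + c₂ - c₁ + c₀ ≠ 0) :
    2 * v₀ ^ 2 + 2 / v₀ ≤ a₁ ^ 2 + a₂ ^ 2 + (B₁ + B₂) := by
  by_contra! hlt
  obtain ⟨-, hv₀2, -, hf₀⟩ := root_bounds hv₀ h₀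
  have hB₁ : 0 ≤ B₁ := by linarith [sq_nonneg t₁]
  have hB₂ : 0 ≤ B₂ := by linarith [sq_nonneg t₂]
  obtain ⟨b₁, hb₁, rfl⟩ : ∃ b, 0 ≤ b ∧ b ^ 2 = B₁ := ⟨√B₁, Real.sqrt_nonneg _, Real.sq_sqrt hB₁⟩
  obtain ⟨b₂, hb₂, rfl⟩ : ∃ b, 0 ≤ b ∧ b ^ 2 = B₂ := ⟨√B₂, Real.sqrt_nonneg _, Real.sq_sqrt hB₂⟩
  obtain ⟨v, hv, hv2⟩ : ∃ v, 0 ≤ v ∧ v ^ 2 = |a₁ * a₂| :=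
    ⟨√|a₁ * a₂|, Real.sqrt_nonneg _, Real.sq_sqrt (abs_nonneg _)⟩
  obtain ⟨w, hw⟩ : ∃ w, b₁ * b₂ = w := ⟨_, rfl⟩
  have hw0 : 0 ≤ w := hw ▸ mul_nonneg hb₁ hb₂
  have hww : b₁ ^ 2 * b₂ ^ 2 = w ^ 2 := by rw [← hw]; ring
  have ha : 2 * v ^ 2 ≤ a₁ ^ 2 + a₂ ^ 2 := by
    rw [hv2, abs_mul, ← sq_abs a₁, ← sq_abs a₂]
    linarith [sq_nonneg (|a₁| - |a₂|)]
  have hbw : b₁ ^ 2 + b₂ ^ 2 = (b₁ - b₂) ^ 2 + 2 * w := by rw [← hw]; ring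
  have hc₀abs : |c₀| = 1 := by
    have h1 : 1 ≤ |c₀| := Int.one_le_abs hP₀
    have h2 : |c₀| < 2 := by
      by_contra! h3
      have h4 : (2 : ℝ) ≤ |(c₀ : ℝ)| := by exact_mod_cast h3
      rw [hc₀, abs_mul, ← hv2, hww, abs_of_nonneg (sq_nonneg w)] at h4
      have h5 : v ^ 2 + w < 1.9 := by linarith [sq_nonneg (b₁ - b₂)]
      -- AM-GM again: `4(v² + w)³ ≥ 27v²w²`, so norm at least 2 in absolute value would make `v² +
      -- w` exceed `1.9`.
      have h6 : 0 ≤ (2 * v ^ 2 - w) ^ 2 * (v ^ 2 + 4 * w) := by positivity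
      have h7 : (v ^ 2 + w) ^ 3 < 1.9 ^ 3 := by gcongr
      linarith
    omega
  have hvw : v * w = 1 := by
    have h1 : |(c₀ : ℝ)| = 1 := by exact_mod_cast hc₀abs
    rw [hc₀, abs_mul, ← hv2, hww, abs_of_nonneg (sq_nonneg w), ← mul_pow] at h1
    exact (pow_eq_one_iff_of_nonneg (by positivity) two_ne_zero).mp h1
  have hv0 : 0 < v := lt_of_le_of_ne hv (by rintro rfl; simp at hvw)
  have hw0' : 0 < w := lt_of_le_of_ne hw0 (by rintro rfl; simp at hvw)
  obtain ⟨hvv, hv1, he⟩ := mean_bounds hv0 hvw hv₀ h₀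
    (e := (a₁ ^ 2 + a₂ ^ 2 - 2 * v ^ 2) + (b₁ - b₂) ^ 2)
    (by linarith [sq_nonneg (b₁ - b₂)]) (by linarith)
  have hvv2 : v ^ 2 < v₀ ^ 2 := by gcongr
  have huw : v ^ 2 * w ^ 2 = 1 := by rw [← mul_pow, hvw, one_pow]
  have hx₁ : 0 ≤ 1 + b₁ ^ 2 - t₁ := by linarith [sq_nonneg (t₁ - 2)]
  have hx₂ : 0 ≤ 1 + b₂ ^ 2 - t₂ := by linarith [sq_nonneg (t₂ - 2)]
  have hy₁ : 0 ≤ 1 + b₁ ^ 2 + t₁ := by linarith [sq_nonneg (t₁ + 2)]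
  have hy₂ : 0 ≤ 1 + b₂ ^ 2 + t₂ := by linarith [sq_nonneg (t₂ + 2)]
  have hX := mul_nonneg hx₁ hx₂
  have hY := mul_nonneg hy₁ hy₂
  have eP : ((1 + c₅ + c₄ + c₃ + c₂ + c₁ + c₀ : ℤ) : ℝ) =
      (1 - (a₁ + a₂) + a₁ * a₂) * ((1 + b₁ ^ 2 - t₁) * (1 + b₂ ^ 2 - t₂)) := by
    push_cast
    rw [hc₀, hc₁, hc₂, hc₃, hc₄, hc₅]
    ring
  have eQ : ((1 - c₅ + c₄ - c₃ + c₂ - c₁ + c₀ : ℤ) : ℝ) =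
      (1 + (a₁ + a₂) + a₁ * a₂) * ((1 + b₁ ^ 2 + t₁) * (1 + b₂ ^ 2 + t₂)) := by
    push_cast
    rw [hc₀, hc₁, hc₂, hc₃, hc₄, hc₅]
    ring
  have hP := one_le_abs_intCast hP₁
  have hQ := one_le_abs_intCast hP₂
  rw [eP] at hP
  rw [eQ] at hQ
  have hb2 := sq_nonneg (b₁ - b₂)
  rcases le_or_gt 0 (a₁ * a₂) with hp | hp
  · rw [abs_of_nonneg hp] at hv2
    rw [← hv2] at hP hQ
    have hA1 : 4 * v ^ 2 ≤ (a₁ + a₂) ^ 2 := by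
      rw [hv2]; linarith [sq_nonneg (a₁ - a₂)]
    have hA2 : (a₁ + a₂) ^ 2 < 4 * v ^ 2 + 0.0063 := by
      have : (a₁ + a₂) ^ 2 = a₁ ^ 2 + a₂ ^ 2 + 2 * v ^ 2 := by rw [hv2]; ring
      linarith
    rcases le_total 0 (a₁ + a₂) with hA | hA
    · exact real_roots_not_same_sign hA hA1 hA2 hv0 hv1 (by linarith) (by linarith) (by linarith)
        (by linarith) hP hQ hX hY
    -- Replacing `α` by `-α` exchanges the norms of `1 - α` and `1 + α`.
    · refine real_roots_not_same_sign (A := -(a₁ + a₂)) (b₁ := b₁) (b₂ := b₂) (t₁ := -t₁)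
        (t₂ := -t₂) (by linarith) (by rwa [neg_sq]) (by rwa [neg_sq]) hv0 hv1 (by linarith)
        (by linarith) (by linarith) (by linarith) ?_ ?_ ?_ ?_ <;>
        simpa only [sub_neg_eq_add, ← sub_eq_add_neg]
  · rw [abs_of_neg hp] at hv2
    have hp' : a₁ * a₂ = -v ^ 2 := by linarith
    have hεe : (a₁ + a₂) ^ 2 = a₁ ^ 2 + a₂ ^ 2 - 2 * v ^ 2 := by
      linear_combination 2 * hp'
    obtain ⟨ε, hε⟩ : ∃ ε, a₁ + a₂ = ε := ⟨_, rfl⟩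
    rw [hε] at hεe
    rw [hε, hp'] at hP hQ hc₁ hc₂ hc₃ hc₄
    rw [hε] at hc₅
    rw [hww] at hc₁ hc₂
    generalize v ^ 2 = u at *
    have he' : ε ^ 2 + (b₁ - b₂) ^ 2 < 0.0063 := by linarith
    have hs' : ε ^ 2 + 2 * u + (b₁ ^ 2 + b₂ ^ 2) < 3.785872 := by linarith
    have hu2 : u < 0.68233 := by linarith
    obtain ⟨hε1, -⟩ := complex_bounds hv1 hu2 hw0' huw hw he' hs'
    rw [abs_lt] at hε1
    have hq1 : 0 ≤ 1 - ε + -u := by linarith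
    have hq2 : 0 ≤ 1 + ε + -u := by linarith
    rw [abs_of_nonneg (mul_nonneg hq1 hX), ← sub_eq_add_neg] at hP
    rw [abs_of_nonneg (mul_nonneg hq2 hY), ← sub_eq_add_neg] at hQ
    have hQ' : 1 ≤ (1 - -ε - u) * ((1 + b₁ ^ 2 - -t₁) * (1 + b₂ ^ 2 - -t₂)) := by
      simpa only [sub_neg_eq_add] using hQ
    have hen : (-ε) ^ 2 = ε ^ 2 := neg_sq ε
    have l1 := trace_lt_two hv1 hu2 hw0' huw hw he' hs' (by linarith) hP
    have l2 := trace_lt_two (t₁ := -t₁) (t₂ := -t₂) (ε := -ε) hv1 hu2 hw0' huw hw (by rwa [hen]) (by rwa [hen]) (by linarith) hQ'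
    have n1 := trace_ne_one hv1 hu2 hw0' huw hw he' hs' hP c₁ c₃ (by linarith) (by linarith)
    have n2 := trace_ne_one hv1 hu2 hw0' huw hw (by rwa [hen]) (by rwa [hen]) hQ' (-c₁) (-c₃)
      (by push_cast; linarith) (by push_cast; linarith)
    have n0 := trace_ne_zero hv1 hvv2 hv₀2 (by rw [← h₀]; ring) hw0' huw hw he' hs' hP c₁ c₂ c₃ c₄
      (by linarith) (by linarith) (by linarith) (by linarith)
    have k1 : -2 < c₅ := by
      have : (-2 : ℝ) < c₅ := by linarith
      exact_mod_cast this
    have k2 : c₅ < 2 := by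
      have : (c₅ : ℝ) < 2 := by linarith
      exact_mod_cast this
    have k3 : c₅ = -1 ∨ c₅ = 0 ∨ c₅ = 1 := by omega
    rcases k3 with rfl | rfl | rfl <;> push_cast at hc₅
    · exact n1 (by linarith)
    · exact n0 (by linarith)
    · exact n2 (by linarith)

theorem sextic_expand (a₁ a₂ t₁ t₂ B₁ B₂ : ℝ) :
    (X - C a₁) * (X - C a₂) * ((X ^ 2 - C t₁ * X + C B₁) * (X ^ 2 - C t₂ * X + C B₂)) =
      X ^ 6 + C (-((a₁ + a₂) + (t₁ + t₂))) * X ^ 5 +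
      C (B₁ + B₂ + t₁ * t₂ + (a₁ + a₂) * (t₁ + t₂) + a₁ * a₂) * X ^ 4 +
      C (-(t₁ * B₂ + t₂ * B₁) - (a₁ + a₂) * (B₁ + B₂ + t₁ * t₂) - a₁ * a₂ * (t₁ + t₂)) * X ^ 3 +
      C (B₁ * B₂ + (a₁ + a₂) * (t₁ * B₂ + t₂ * B₁) + a₁ * a₂ * (B₁ + B₂ + t₁ * t₂)) * X ^ 2 +
      C (-(a₁ + a₂) * (B₁ * B₂) - a₁ * a₂ * (t₁ * B₂ + t₂ * B₁)) * X +
      C (a₁ * a₂ * (B₁ * B₂)) := by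
  simp only [C_add, C_neg, C_sub, C_mul]
  ring

theorem le_minDistance_sq_of_signature_two_two {K : Type*} [Field K] [NumberField K]
    (hK : HasSignature K 2 2) {v₀ : ℝ} (hv₀ : 0 < v₀) (h₀ : v₀ ^ 6 + v₀ ^ 2 = 1) :
    2 * v₀ ^ 2 + 2 / v₀ ≤ minDistance K ^ 2 := by
  classical
  refine le_minDistance_sq fun α hα => ?_
  by_cases hα1 : α = 1 ∨ α = -1
  · rw [sum_sq_eq_card_of_eq_one_or_neg_one hα1, card_eq_nrRealPlaces_add_nrComplexPlaces, hK.1,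
      hK.2]
    have := (root_bounds hv₀ h₀).2.2.2
    norm_num
    linarith
  push Not at hα1
  obtain ⟨a, t, B, P, ht, hP, hsum, hne⟩ := exists_charpoly_of_hasSignature hK α
  simp only [Fin.prod_univ_two] at hP
  rw [sextic_expand] at hP
  have hcoeff := fun k => congrArg (fun Q : ℝ[X] => Q.coeff k) hP
  have h0 := hcoeff 0
  have h1 := hcoeff 1
  have h2 := hcoeff 2
  have h3 := hcoeff 3
  have h4 := hcoeff 4
  have h5 := hcoeff 5
  simp only [coeff_map, eq_intCast, coeff_add, coeff_C_mul, coeff_X_pow, coeff_X, coeff_C] at h0 h1 h2 h3 h4 h5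
  norm_num at h0 h1 h2 h3 h4 h5
  have hev : ∀ k : ℤ, P.eval k = k ^ 6 + P.coeff 5 * k ^ 5 + P.coeff 4 * k ^ 4 + P.coeff 3 * k ^ 3 +
      P.coeff 2 * k ^ 2 + P.coeff 1 * k + P.coeff 0 := fun k => by
    have h := congrArg (Polynomial.eval (k : ℝ)) hP
    rw [Polynomial.eval_intCast_map] at h
    simp only [eval_add, eval_mul, eval_pow, eval_X, eval_C, eq_intCast, Int.cast_id] at h
    have : ((P.eval k : ℤ) : ℝ) = ((k ^ 6 + P.coeff 5 * k ^ 5 + P.coeff 4 * k ^ 4 +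
        P.coeff 3 * k ^ 3 + P.coeff 2 * k ^ 2 + P.coeff 1 * k + P.coeff 0 : ℤ) : ℝ) := by
      rw [h]
      push_cast
      rw [h0, h1, h2, h3, h4, h5]
      ring
    exact_mod_cast this
  have hnz : ∀ k : ℤ, α ≠ k → P.eval k ≠ 0 := fun k hk h => hk (hne k h)
  rw [hsum]
  simp only [Fin.sum_univ_two]
  refine le_sum_sq_roots hv₀ h₀ (ht 0) (ht 1) (P.coeff 0) (P.coeff 1) (P.coeff 2) (P.coeff 3)
    (P.coeff 4) (P.coeff 5) (by rw [h5]; ring) (by rw [h4]) (by rw [h3]; ring) (by rw [h2])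
    (by rw [h1]; ring) (by rw [h0]) ?_ ?_ ?_
  · have := hnz 0 (by simpa using hα)
    rw [hev] at this
    simpa using this
  · have := hnz 1 (by simpa using hα1.1)
    rw [hev] at this
    simpa using this
  · have := hnz (-1) (by simpa using hα1.2)
    rw [hev] at this
    convert this using 1
    ring

/-! ### Irreducibility of `X⁶ + X² - 1` -/

theorem natDegree_sextic (R : Type*) [CommRing R] [Nontrivial R] :
    (X ^ 6 + X ^ 2 - 1 : R[X]).natDegree = 6 := by
  compute_degree!

theorem monic_sextic (R : Type*) [CommRing R] : (X ^ 6 + X ^ 2 - 1 : R[X]).Monic := by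
  nontriviality R
  monicity!

/-- Coefficients of `(X² + pX + q)(X⁴ + aX³ + bX² + cX + d)`; the constant terms are `±1`, and
elimination leaves `2c² = 3` or `0 = 1`. -/
theorem no_quadratic_factor {p q a b c d : ℤ} (h5 : p + a = 0) (h4 : b + p * a + q = 0)
    (h3 : c + p * b + q * a = 0) (h2 : d + p * c + q * b = 1) (h1 : p * d + q * c = 0)
    (h0 : q * d = -1) : False := by
  obtain rfl : a = -p := by linarith
  rcases Int.mul_eq_neg_one_iff_eq_one_or_neg_one.mp h0 with ⟨rfl, rfl⟩ | ⟨rfl, rfl⟩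
  · obtain rfl : c = p := by linarith
    obtain rfl : b = c ^ 2 - 1 := by linarith
    have : 2 * c ^ 2 = 3 := by linarith
    omega
  · obtain rfl : c = p := by linarith
    obtain rfl : b = c ^ 2 + 1 := by linarith
    linarith

/-- Elimination gives `2q = p²` and `q² = 1 ± 2p`; then `p` is even, `q` is even, and the second
equation fails modulo 4. -/
theorem no_cubic_factor {p q r p' q' r' : ℤ} (h5 : p + p' = 0) (h4 : q + q' + p * p' = 0)
    (h2 : p * r' + p' * r + q * q' = 1) (h1 : q * r' + q' * r = 0) (h0 : r * r' = -1) : False := by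
  obtain rfl : p' = -p := by linarith
  have key : ∀ s : ℤ, 2 * q = p ^ 2 → q ^ 2 = 1 + 2 * s * p → False := fun s e1 e2 => by
    have hp : Even p := (Int.even_pow.mp (⟨q, by linarith⟩ : Even (p ^ 2))).1
    obtain ⟨k, rfl⟩ := hp
    obtain rfl : q = 2 * k ^ 2 := by linarith
    have : 4 * (k ^ 4 - s * k) = 1 := by linarith
    omega
  rcases Int.mul_eq_neg_one_iff_eq_one_or_neg_one.mp h0 with ⟨rfl, rfl⟩ | ⟨rfl, rfl⟩
  · obtain rfl : q' = q := by linarith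
    exact key 1 (by linarith) (by linarith)
  · obtain rfl : q' = q := by linarith
    exact key (-1) (by linarith) (by linarith)

theorem irreducible_sextic_int : Irreducible (X ^ 6 + X ^ 2 - 1 : ℤ[X]) := by
  rw [(monic_sextic ℤ).irreducible_iff_natDegree']
  refine ⟨fun h => by simpa [natDegree_sextic] using congrArg natDegree h, ?_⟩
  intro f g hf hg hfg hd
  rw [natDegree_sextic, Finset.mem_Ioc] at hd
  have hdeg : f.natDegree + g.natDegree = 6 := by
    rw [← hf.natDegree_mul hg, hfg, natDegree_sextic]
  have hc := fun k => congrArg (fun Q : ℤ[X] => Q.coeff k) hfg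
  have c0 := hc 0
  have c1 := hc 1
  have c2 := hc 2
  have c3 := hc 3
  have c4 := hc 4
  have c5 := hc 5
  simp only [coeff_mul, Finset.Nat.sum_antidiagonal_eq_sum_range_succ_mk, Finset.sum_range_succ,
    Finset.sum_range_zero, coeff_sub, coeff_add, coeff_X_pow, coeff_one] at c0 c1 c2 c3 c4 c5
  norm_num at c0 c1 c2 c3 c4 c5
  have hcases : g.natDegree = 1 ∨ g.natDegree = 2 ∨ g.natDegree = 3 := by omega
  have hz : ∀ {h : ℤ[X]} {n : ℕ}, h.natDegree < n → h.coeff n = 0 :=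
    fun h => coeff_eq_zero_of_natDegree_lt h
  rcases hcases with h | h | h
  · have hroot : g.eval (-g.coeff 0) = 0 := by
      rw [hg.as_sum, h]
      simp
    have he := congrArg (Polynomial.eval (-g.coeff 0)) hfg
    rw [eval_mul, hroot] at he
    simp only [eval_sub, eval_add, eval_pow, eval_X, eval_one, mul_zero] at he
    generalize -g.coeff 0 = c at he
    have hu : c * (c * (c ^ 4 + 1)) = 1 := by linarith
    rcases Int.eq_one_or_neg_one_of_mul_eq_one hu with rfl | rfl <;> norm_num at he
  · have hf4 : f.natDegree = 4 := by omega
    have g2 : g.coeff 2 = 1 := h ▸ hg.coeff_natDegree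
    have f4 : f.coeff 4 = 1 := hf4 ▸ hf.coeff_natDegree
    simp only [hz (h := g) (n := 3) (by omega), hz (h := g) (n := 4) (by omega),
      hz (h := g) (n := 5) (by omega), hz (h := f) (n := 5) (by omega), g2, f4] at c0 c1 c2 c3 c4 c5
    exact no_quadratic_factor (p := g.coeff 1) (q := g.coeff 0) (a := f.coeff 3) (b := f.coeff 2)
      (c := f.coeff 1) (d := f.coeff 0) (by linarith) (by linarith) (by linarith) (by linarith)
      (by linarith) (by linarith)
  · have hf3 : f.natDegree = 3 := by omega
    have g3 : g.coeff 3 = 1 := h ▸ hg.coeff_natDegree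
    have f3 : f.coeff 3 = 1 := hf3 ▸ hf.coeff_natDegree
    simp only [hz (h := g) (n := 4) (by omega), hz (h := g) (n := 5) (by omega),
      hz (h := f) (n := 4) (by omega), hz (h := f) (n := 5) (by omega), g3, f3] at c0 c1 c2 c3 c4 c5
    exact no_cubic_factor (p := g.coeff 2) (q := g.coeff 1) (r := g.coeff 0) (p' := f.coeff 2)
      (q' := f.coeff 1) (r' := f.coeff 0) (by linarith) (by linarith) (by linarith) (by linarith)
      (by linarith)

theorem irreducible_sextic : Irreducible (X ^ 6 + X ^ 2 - 1 : ℚ[X]) := by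
  have h := (IsPrimitive.Int.irreducible_iff_irreducible_map_cast (monic_sextic ℤ).isPrimitive).mp
    irreducible_sextic_int
  simpa using h

/-! ### The field generated by a root of `x⁶ + x² - 1` -/

theorem exists_real_root : ∃ v : ℝ, 0 < v ∧ v ^ 6 + v ^ 2 = 1 := by
  have hcont : ContinuousOn (fun v : ℝ => v ^ 6 + v ^ 2) (Set.Icc 0 1) := by fun_prop
  obtain ⟨v, hv, hv1⟩ := intermediate_value_Icc (zero_le_one' ℝ) hcont
    (show (1 : ℝ) ∈ Set.Icc _ _ by norm_num)
  refine ⟨v, lt_of_le_of_ne hv.1 ?_, hv1⟩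
  rintro rfl
  norm_num at hv1

/-- The complex roots of `x ^ 6 + x ^ 2 - 1`. -/
theorem complex_root_cases {v₀ : ℝ} (hv₀ : 0 < v₀) (h₀ : v₀ ^ 6 + v₀ ^ 2 = 1) {z : ℂ}
    (hz : z ^ 6 + z ^ 2 - 1 = 0) :
    (z = v₀ ∨ z = -v₀) ∨ (z.im ≠ 0 ∧ ‖z‖ ^ 2 = 1 / v₀) := by
  have h₀' : (v₀ : ℂ) ^ 6 + (v₀ : ℂ) ^ 2 = 1 := by exact_mod_cast h₀
  have hfac : (z - v₀) * (z + v₀) * ((z ^ 2) ^ 2 + v₀ ^ 2 * z ^ 2 + (v₀ ^ 4 + 1)) = 0 := by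
    linear_combination hz - h₀'
  rcases mul_eq_zero.mp hfac with h | h
  · left
    rcases mul_eq_zero.mp h with h | h
    · exact Or.inl (sub_eq_zero.mp h)
    · exact Or.inr (eq_neg_of_add_eq_zero_left h)
  · right
    obtain ⟨y, hy⟩ : ∃ y, y = z ^ 2 := ⟨_, rfl⟩
    rw [← hy] at h
    have hre := congrArg Complex.re h
    have him := congrArg Complex.im h
    have hr4 : ((v₀ : ℂ) ^ 4 + 1) = ((v₀ ^ 4 + 1 : ℝ) : ℂ) := by push_cast; ring
    have hr2 : (v₀ : ℂ) ^ 2 = ((v₀ ^ 2 : ℝ) : ℂ) := by push_cast; ring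
    rw [hr4, hr2, pow_two y] at hre him
    simp only [Complex.add_re, Complex.add_im, Complex.mul_re, Complex.mul_im, Complex.ofReal_re,
      Complex.ofReal_im, Complex.zero_re, Complex.zero_im] at hre him
    have hq : y.im ≠ 0 := fun h0 => by
      rw [h0] at hre
      -- A real `y` would be a root of `y² + v₀²y + v₀⁴ + 1`, whose discriminant is negative.
      nlinarith [sq_nonneg (2 * y.re + v₀ ^ 2), sq_nonneg (v₀ ^ 2)]
    have hp : 2 * y.re + v₀ ^ 2 = 0 := by
      have : y.im * (2 * y.re + v₀ ^ 2) = 0 := by linarith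
      exact (mul_eq_zero.mp this).resolve_left hq
    have hn : ‖y‖ ^ 2 = v₀ ^ 4 + 1 := by
      rw [Complex.sq_norm, Complex.normSq_apply]
      linear_combination -hre + (y.re) * hp
    refine ⟨fun h0 => hq ?_, ?_⟩
    · rw [hy, pow_two, Complex.mul_im, h0]
      ring
    · rw [hy, norm_pow] at hn
      -- Since `v₀²(v₀⁴ + 1) = 1`.
      have h1 : (‖z‖ ^ 2 * v₀) ^ 2 = 1 := by
        linear_combination v₀ ^ 2 * hn + h₀
      rw [eq_div_iff hv₀.ne']
      exact (pow_eq_one_iff_of_nonneg (by positivity) two_ne_zero).mp h1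

section

variable {K : Type*} [Field K] [NumberField K] {α : K}

theorem minpoly_eq_sextic (hα : α ^ 6 + α ^ 2 - 1 = 0) :
    minpoly ℚ α = X ^ 6 + X ^ 2 - 1 :=
  (minpoly.eq_of_irreducible_of_monic irreducible_sextic (by simpa using hα)
    (monic_sextic ℚ)).symm

theorem finrank_eq_six (hα : α ^ 6 + α ^ 2 - 1 = 0) (htop : IntermediateField.adjoin ℚ {α} = ⊤) :
    Module.finrank ℚ K = 6 := by
  rw [← (Field.primitive_element_iff_minpoly_natDegree_eq ℚ α).mp htop, minpoly_eq_sextic hα,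
    natDegree_sextic]

theorem ringHom_eq_of_apply_eq (htop : IntermediateField.adjoin ℚ {α} = ⊤) {φ ψ : K →+* ℂ}
    (h : φ α = ψ α) : φ = ψ := by
  have := (Field.primitive_element_iff_algHom_eq_of_eval ℚ ℂ
    (fun _ => IsAlgClosed.splits _) α φ.toRatAlgHom).mp htop ψ.toRatAlgHom h
  exact RingHom.ext fun x => congrArg (fun f : K →ₐ[ℚ] ℂ => f x) this

theorem isReal_iff_im_eq_zero (htop : IntermediateField.adjoin ℚ {α} = ⊤) {φ : K →+* ℂ} :
    ComplexEmbedding.IsReal φ ↔ (φ α).im = 0 := by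
  rw [← Complex.conj_eq_iff_im]
  exact ⟨fun h => RingHom.congr_fun h α, fun h => ringHom_eq_of_apply_eq htop h⟩

theorem exists_embedding_apply_eq (hα : α ^ 6 + α ^ 2 - 1 = 0) {z : ℂ}
    (hz : z ^ 6 + z ^ 2 - 1 = 0) : ∃ φ : K →+* ℂ, φ α = z := by
  have : z ∈ Set.range fun φ : K →+* ℂ => φ α := by
    rw [NumberField.Embeddings.range_eval_eq_rootSet_minpoly, minpoly_eq_sextic hα,
      mem_rootSet_of_ne (monic_sextic ℚ).ne_zero]
    simpa using hz
  exact this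

theorem embedding_root (hα : α ^ 6 + α ^ 2 - 1 = 0) (φ : K →+* ℂ) :
    φ α ^ 6 + φ α ^ 2 - 1 = 0 := by
  have := congrArg φ hα
  simpa using this

theorem hasSignature_two_two (hα : α ^ 6 + α ^ 2 - 1 = 0)
    (htop : IntermediateField.adjoin ℚ {α} = ⊤) : HasSignature K 2 2 := by
  classical
  obtain ⟨v, hv, h₀⟩ := exists_real_root
  have hvr : (v : ℂ) ^ 6 + (v : ℂ) ^ 2 - 1 = 0 := by
    rw [sub_eq_zero]
    exact_mod_cast h₀
  obtain ⟨φ, hφ⟩ := exists_embedding_apply_eq hα hvr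
  obtain ⟨ψ, hψ⟩ := exists_embedding_apply_eq hα (z := -v) (by linear_combination hvr)
  have hne : φ ≠ ψ := by
    rintro rfl
    rw [hφ] at hψ
    have : v = -v := by exact_mod_cast hψ
    linarith
  have hreal : nrRealPlaces K = 2 := by
    rw [← card_real_embeddings, Fintype.card_subtype, ← Finset.card_pair hne]
    congr 1
    ext χ
    simp only [Finset.mem_filter, Finset.mem_univ, true_and, Finset.mem_insert,
      Finset.mem_singleton, isReal_iff_im_eq_zero htop]
    constructor
    · intro h
      rcases complex_root_cases hv h₀ (embedding_root hα χ) with (h1 | h1) | h1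
      · exact Or.inl (ringHom_eq_of_apply_eq htop (h1.trans hφ.symm))
      · exact Or.inr (ringHom_eq_of_apply_eq htop (h1.trans hψ.symm))
      · exact absurd h h1.1
    · rintro (rfl | rfl)
      · simp [hφ]
      · simp [hψ]
  refine ⟨hreal, ?_⟩
  have := card_add_two_mul_card_eq_rank K
  rw [hreal, finrank_eq_six hα htop] at this
  omega

open scoped Classical in
theorem sum_sq_generator (hα : α ^ 6 + α ^ 2 - 1 = 0)
    (htop : IntermediateField.adjoin ℚ {α} = ⊤) {v₀ : ℝ} (hv₀ : 0 < v₀)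
    (h₀ : v₀ ^ 6 + v₀ ^ 2 = 1) :
    ∑ w : InfinitePlace K, w α ^ 2 = 2 * v₀ ^ 2 + 2 / v₀ := by
  have hsig := hasSignature_two_two hα htop
  have hr : ∀ w : {w : InfinitePlace K // IsReal w}, w.1 α ^ 2 = v₀ ^ 2 := fun w => by
    have him := (isReal_iff_im_eq_zero htop).mp (isReal_iff.mp w.2)
    rw [← norm_embedding_eq]
    rcases complex_root_cases hv₀ h₀ (embedding_root hα w.1.embedding) with (h | h) | h
    · rw [h]; simp
    · rw [h]; simp
    · exact absurd him h.1
  have hc : ∀ w : {w : InfinitePlace K // IsComplex w}, w.1 α ^ 2 = 1 / v₀ := fun w => by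
    have him := (isReal_iff_im_eq_zero htop).not.mp (isComplex_iff.mp w.2)
    rw [← norm_embedding_eq]
    rcases complex_root_cases hv₀ h₀ (embedding_root hα w.1.embedding) with (h | h) | h
    · rw [h] at him; simp at him
    · rw [h] at him; simp at him
    · exact h.2
  rw [sum_eq_sum_add_sum]
  simp only [hr, hc, Finset.sum_const, Finset.card_univ, nsmul_eq_mul]
  rw [(Fintype.card_congr (Equiv.refl _)).trans hsig.1,
    (Fintype.card_congr (Equiv.refl _)).trans hsig.2]
  push_cast
  ring

theorem minDistance_sq_eq (hα : α ^ 6 + α ^ 2 - 1 = 0)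
    (htop : IntermediateField.adjoin ℚ {α} = ⊤) {v₀ : ℝ} (hv₀ : 0 < v₀)
    (h₀ : v₀ ^ 6 + v₀ ^ 2 = 1) : minDistance K ^ 2 = 2 * v₀ ^ 2 + 2 / v₀ := by
  refine le_antisymm ?_
    (le_minDistance_sq_of_signature_two_two (hasSignature_two_two hα htop) hv₀ h₀)
  have hint : IsIntegral ℤ α :=
    ⟨X ^ 6 + X ^ 2 - 1, monic_sextic ℤ, by simpa using hα⟩
  rw [← sum_sq_generator hα htop hv₀ h₀]
  refine minDistance_sq_le (⟨α, hint⟩ : 𝓞 K) fun h => ?_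
  have h0 : α = 0 := congrArg (fun x : 𝓞 K => (x : K)) h
  rw [h0] at hα
  norm_num at hα

end

/-- Ensures that the statement about fields generated by a root is not vacuous. -/
theorem exists_sextic_field : ∃ (K : Type) (_ : Field K) (_ : NumberField K) (α : K),
    α ^ 6 + α ^ 2 - 1 = 0 ∧ IntermediateField.adjoin ℚ {α} = ⊤ := by
  have : Fact (Irreducible (X ^ 6 + X ^ 2 - 1 : ℚ[X])) := ⟨irreducible_sextic⟩
  have hfin : FiniteDimensional ℚ (AdjoinRoot (X ^ 6 + X ^ 2 - 1 : ℚ[X])) :=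
    (AdjoinRoot.powerBasis irreducible_sextic.ne_zero).finite
  refine ⟨AdjoinRoot (X ^ 6 + X ^ 2 - 1 : ℚ[X]), inferInstance,
    { to_charZero := charZero_of_injective_algebraMap (algebraMap ℚ _).injective
      to_finiteDimensional := ?_ }, AdjoinRoot.root _, ?_, ?_⟩
  -- The two `ℚ`-algebra structures, from `AdjoinRoot` and from characteristic zero, have to be
  -- identified.
  · convert! hfin
  · have h := AdjoinRoot.mk_self (f := (X ^ 6 + X ^ 2 - 1 : ℚ[X]))
    rwa [map_sub, map_add, map_pow, map_pow, map_one, AdjoinRoot.mk_X] at h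
  · rw [eq_top_iff]
    intro x _
    induction x using AdjoinRoot.induction_on with
    | ih p =>
      induction p using Polynomial.induction_on' with
      | add p q hp hq =>
        rw [map_add]
        exact add_mem (hp trivial) (hq trivial)
      | monomial n a =>
        rw [← C_mul_X_pow_eq_monomial, map_mul, map_pow, AdjoinRoot.mk_X, AdjoinRoot.mk_C,
          eq_ratCast]
        exact mul_mem (SubfieldClass.ratCast_mem _ a)
          (pow_mem (IntermediateField.mem_adjoin_simple_self ℚ _) n)

theorem theorem4p4 :
    -- (i) signature (2, 2)
    ((∃ (K : Type) (_ : Field K) (_ : NumberField K) (α : K),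
        α ^ 6 + α ^ 2 - 1 = 0 ∧ IntermediateField.adjoin ℚ {α} = ⊤) ∧
      ∀ (K : Type*) [Field K] [NumberField K] (α : K),
        α ^ 6 + α ^ 2 - 1 = 0 → IntermediateField.adjoin ℚ {α} = ⊤ →
          (Module.finrank ℚ K = 6 ∧ HasSignature K 2 2) ∧
          (0.946467 ≤ normalizedMin K ∧ normalizedMin K < 0.946468) ∧
          ∀ (L : Type*) [Field L] [NumberField L],
            Module.finrank ℚ L = 6 → HasSignature L 2 2 → normalizedMin K ≤ normalizedMin L) ∧
    -- (ii) signature (4, 1)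
    (∀ (K : Type*) [Field K] [NumberField K],
      Module.finrank ℚ K = 6 → HasSignature K 4 1 → normalizedMin K = 1) := by
  refine ⟨⟨exists_sextic_field, ?_⟩, fun K _ _ _ hK =>
    normalizedMin_eq_one_of_signature_four_one K hK⟩
  intro K _ _ α hα htop
  obtain ⟨v₀, hv₀, h₀⟩ := exists_real_root
  have hsig := hasSignature_two_two hα htop
  have hmin := minDistance_sq_eq hα htop hv₀ h₀
  obtain ⟨-, -, h1, h2⟩ := root_bounds hv₀ h₀
  have hnorm : normalizedMin K = (2 * v₀ ^ 2 + 2 / v₀) / 4 := by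
    rw [normalizedMin, hmin, hsig.1, hsig.2]
    norm_num
  refine ⟨⟨finrank_eq_six hα htop, hsig⟩, ⟨by linarith, by linarith⟩, ?_⟩
  intro L _ _ _ hL
  have hle := le_minDistance_sq_of_signature_two_two hL hv₀ h₀
  rw [hnorm, normalizedMin, hL.1, hL.2]
  norm_num
  linarith
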